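/- **Corollary (generalization bound for ResNet).** Let $n,m\ge 1$ and $T\ge 2$ be integers. Let $D$ be a probability distribution on pairs $(x,y)$ with $x\in\mathbb{R}^n$ and $y\in\{-1,+1\}$, and let $S=((x_1,y_1),\dots,(x_m,y_m))$ be a sample of $m$ points drawn independently from $D$. Assume that $$r_\infty := \mathbb{E}_{S}\Big[\max_{1\le i\le m}\|x_i\|_\infty\Big]<\infty .$$ Let $\sigma_0,\sigma_1,\dots:\mathbb{R}\to\mathbb{R}$ be activation functions that are $1$-Lipschitz with $\sigma_t(0)=0$ (for instance, all equal to one activation $\sigma$, or $\sigma_0=\mathrm{id}$ and $\sigma_t=\sigma$ for $t\ge1$), and let $\Lambda_{t,t-1}\ge 0$ for $t\ge 0$. Define families of functions $\mathbb{R}^n\to\mathbb{R}$ by $$\mathcal{F}_0=\Big\{x\mapsto \sum_{i=1}^n u_i\,\sigma_0(x_i)\;:\;u\in\mathbb{R}^n,\ \|u\|_1\le\Lambda_{0,-1}\Big\},$$ $$\mathcal{F}_t=\Big\{x\mapsto \sum_{i=1}^n u_i\,\sigma_t(h_i(x))\;:\;u\in\mathbb{R}^n,\ \|u\|_1\le\Lambda_{t,t-1},\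 h_1,\dots,h_n\in\mathcal{F}_{t-1}\Big\}\qquad(t\ge1),$$ and put $\Lambda_t=\prod_{t'=0}^t 2\Lambda_{t',t'-1}$. Consider networks $$F(x)=w^\top\sum_{t=0}^T f_t(x),\qquad w\in\mathbb{R}^n,\quad f_t=(f_{t,1},\dots,f_{t,n}),\quad f_{t,j}\in\mathcal{F}_t ,$$ where $f_t(x)$ is the output of the $t$-th module (in ResNet notation $f_t(g_t(x))$) as a function of the network input $x$. Write $\Pr_D(yF(x)\le0)$ for the probability under $D$, and $\Pr_S(yF(x)\le\theta)=\frac1m\#\{i: y_iF(x_i)\le\theta\}$. Fix $\theta>0$ and $\delta\in(0,1)$. With probability at least $1-\delta$ over the draw of $S$, simultaneously for all $w\in\mathbb{R}^n$ and all $f_{t,j}\in\mathcal{F}_t$ ($0\le t\le T$, $1\le j\le n$), $$\Pr_D\big(yF(x)\le 0\big)\le \Pr_S\big(yF(x)\le\theta\big)+\frac{4\|w\|_1 r_\infty}{\theta}\sqrt{\frac{\log(2n)}{2m}}\sum_{t=0}^T\Lambda_t+\frac2\theta\sqrt{\frac{\log T}{m}}+\sqrt{\left\lceil\frac4{\theta^2}\log\Big(\frac{\theta^2m}{\log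 T}\Big)\right\rceil\frac{\log T}{m}+\frac{\log\frac2\delta}{2m}} ,$$ where the last square root is read as $0$ if its argument is negative (this can happen only when $\frac2\theta\sqrt{\frac{\log T}{m}}\ge 2$, so that the bound is trivial). -/

import Mathlib

open MeasureTheory
open scoped BigOperators

noncomputable section

namespace ResNetBound

/-- The family of real functions of the network input `x : Fin n → ℝ` that a unit of the `t`-th
one-layer module can realize: `x ↦ ∑ i, u i * σ t (f i x)`, where the `ℓ₁` norm of `u` is at most
`lam t` and every `f i` is realized by a unit of the previous module; for `t = 0` the previous
layer is the input itself, so that `f i x = x i`. -/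
def unitFamily (n : ℕ) (σ : ℕ → ℝ → ℝ) (lam : ℕ → ℝ) : ℕ → Set ((Fin n → ℝ) → ℝ)
  | 0 => {h | ∃ u : Fin n → ℝ, ∑ i, |u i| ≤ lam 0 ∧ h = fun x => ∑ i, u i * σ 0 (x i)}
  | t + 1 => {h | ∃ u : Fin n → ℝ, ∑ i, |u i| ≤ lam (t + 1) ∧
      ∃ f : Fin n → (Fin n → ℝ) → ℝ, (∀ i, f i ∈ unitFamily n σ lam t) ∧
        h = fun x => ∑ i, u i * σ (t + 1) (f i x)}

/-- The network output `w ⬝ ∑ t ≤ T, f t x`, where `f t j x` is the output at input `x` of the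
`j`-th unit of the `t`-th module. -/
def resNet {n : ℕ} (T : ℕ) (w : Fin n → ℝ) (f : ℕ → Fin n → (Fin n → ℝ) → ℝ)
    (x : Fin n → ℝ) : ℝ :=
  ∑ j, w j * ∑ t ∈ Finset.range (T + 1), f t j x

/-- The law of a sample of `m` independent labelled points with law `D`. -/
def sampleLaw {n : ℕ} (D : Measure ((Fin n → ℝ) × ℝ)) (m : ℕ) :
    Measure (Fin m → (Fin n → ℝ) × ℝ) :=
  Measure.pi fun _ => D

/-- The maximal sup norm of an input in the sample `S` (the norm of `Fin n → ℝ` is the sup norm). -/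
def maxInputNorm {n m : ℕ} (S : Fin m → (Fin n → ℝ) × ℝ) : ℝ :=
  ⨆ i, ‖(S i).1‖

/-- The expectation of the maximal sup norm of an input in a sample of size `m`. -/
def rInf {n : ℕ} (D : Measure ((Fin n → ℝ) × ℝ)) (m : ℕ) : ℝ :=
  ∫ S, maxInputNorm S ∂(sampleLaw D m)

/-- The product over `s ≤ t` of `2 * lam s`. -/
def weightProd (lam : ℕ → ℝ) (t : ℕ) : ℝ :=
  ∏ s ∈ Finset.range (t + 1), 2 * lam s

/-- The probability under `D` that `y * F x ≤ 0`. -/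
def trueError {n : ℕ} (D : Measure ((Fin n → ℝ) × ℝ)) (F : (Fin n → ℝ) → ℝ) : ℝ :=
  D.real {z | z.2 * F z.1 ≤ 0}

/-- The fraction of the points `(x, y)` of the sample with `y * F x ≤ θ`. -/
def marginError {n m : ℕ} (S : Fin m → (Fin n → ℝ) × ℝ) (θ : ℝ) (F : (Fin n → ℝ) → ℝ) : ℝ :=
  ((Finset.univ.filter fun i => (S i).2 * F (S i).1 ≤ θ).card : ℝ) / m

end ResNetBound

end

/-! For a fixed cap `a` on the `ℓ₁` norm of the output weights, this is the classical Rademacher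
argument. The ramp loss lies between the two error indicators. McDiarmid's inequality
(`measure_ge_le_of_bounded_differences`) concentrates the largest deviation at its mean,
symmetrization (`integral_uniformDeviation_le`) bounds the mean by twice a Rademacher average, and
Talagrand's contraction removes the ramp. The average of the network class is computed module by
module: Massart's lemma on the input coordinates, then a factor `2 * lam t` per layer
(`signAbsSum_unitFamily_le`). It is linear in the largest input norm of the sample, so its
expectation produces `rInf`, and integrability is the only moment condition.

Uniformity in `w` comes from peeling over caps growing like `(3/2) ^ k`. The deviation allowed at
scale `k` exceeds `s` by a multiple of the complexity there; this makes the failure probabilities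
summable and raises the constant from 2 to 4. The scales need a smallest one. Below it, a margin
above `θ` requires an input norm above `22 * rInf`; by Markov's inequality such inputs are so rare
that their number in the sample has a Poisson tail, so the margin error is nearly 1
(`exists_measurableSet_small_weights_bound`).

All failures together cost `8 * exp (-2 m s²)`. When the claimed bound is below 1 its ceiling is at
least 1, so its last root dominates an `s` for which this cost is at most `δ`. -/

namespace ResNetBound

/-! ### Concentration: Hoeffding's lemma and McDiarmid's inequality. -/

section BoundedDifferences

variable {Ω : Type*} [MeasurableSpace Ω]

lemma integral_exp_le_of_oscillation (μ : Measure Ω) [IsProbabilityMeasure μ] {X : Ω → ℝ}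
    (hX : Measurable X) {c : ℝ} (hc : ∀ x y, |X x - X y| ≤ c) (l : ℝ) :
    ∫ x, Real.exp (l * X x) ∂μ ≤ Real.exp (l * ∫ x, X x ∂μ + l ^ 2 * c ^ 2 / 8) := by
  have hne : Nonempty Ω := nonempty_of_isProbabilityMeasure μ
  obtain ⟨x₀⟩ := hne
  have hc0 : 0 ≤ c := (abs_nonneg _).trans (hc x₀ x₀)
  have hbdd : BddBelow (Set.range X) := by
    refine ⟨X x₀ - c, ?_⟩
    rintro _ ⟨y, rfl⟩
    linarith [(abs_le.1 (hc x₀ y)).2]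
  have hmem : ∀ x, X x ∈ Set.Icc (⨅ y, X y) ((⨅ y, X y) + c) := by
    intro x
    have : Nonempty Ω := ⟨x₀⟩
    refine ⟨ciInf_le hbdd x, ?_⟩
    have : X x - c ≤ ⨅ y, X y := le_ciInf fun y => by linarith [(abs_le.1 (hc x y)).2]
    linarith
  have h := (ProbabilityTheory.hasSubgaussianMGF_of_mem_Icc (μ := μ) hX.aemeasurable
    (Filter.Eventually.of_forall hmem)).mgf_le l
  have e : ∀ x, Real.exp (l * X x) =
      Real.exp (l * ∫ x, X x ∂μ) * Real.exp (l * (X x - ∫ x, X x ∂μ)) := by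
    intro x; rw [← Real.exp_add]; congr 1; ring
  simp_rw [e]
  rw [integral_const_mul, Real.exp_add]
  refine mul_le_mul_of_nonneg_left (h.trans (le_of_eq ?_)) (Real.exp_pos _).le
  congr 1
  simp [abs_of_nonneg hc0]
  ring

lemma integrable_of_abs_le {μ : Measure Ω} [IsFiniteMeasure μ] {f : Ω → ℝ} (hf : Measurable f)
    {C : ℝ} (hC : ∀ x, |f x| ≤ C) : Integrable f μ :=
  Integrable.of_bound hf.aestronglyMeasurable C (Filter.Eventually.of_forall hC)

lemma integrable_exp_of_abs_le {μ : Measure Ω} [IsFiniteMeasure μ] {f : Ω → ℝ}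
    (hf : Measurable f) {C : ℝ} (hC : ∀ x, |f x| ≤ C) (l : ℝ) :
    Integrable (fun x => Real.exp (l * f x)) μ := by
  refine integrable_of_abs_le (C := Real.exp (|l| * C)) (by fun_prop) fun x => ?_
  rw [Real.abs_exp]
  refine Real.exp_le_exp.2 ((le_abs_self _).trans ?_)
  rw [abs_mul]
  exact mul_le_mul_of_nonneg_left (hC x) (abs_nonneg _)

/-- Induction on `m`, isolating the first point. The mean over the remaining points is a function of
the first one with oscillation at most `c`, to which Hoeffding's lemma applies; the sections with
the first point fixed again have bounded differences. -/
lemma integral_exp_le_of_bounded_differences (μ : Measure Ω) [IsProbabilityMeasure μ] (c l : ℝ) :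
    ∀ (m : ℕ) (f : (Fin m → Ω) → ℝ), Measurable f → (∃ C, ∀ S, |f S| ≤ C) →
      (∀ S i z, |f S - f (Function.update S i z)| ≤ c) →
      ∫ S, Real.exp (l * f S) ∂(Measure.pi fun _ => μ) ≤
        Real.exp (l * ∫ S, f S ∂(Measure.pi fun _ => μ) + m * (l ^ 2 * c ^ 2 / 8)) := by
  intro m
  induction m with
  | zero =>
    intro f _ _ _
    have : ∀ S, f S = f default := fun S => congrArg f (Subsingleton.elim _ _)
    simp_rw [this]
    simp
  | succ m ih =>
    rintro f hf ⟨C, hC⟩ hd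
    have hmp := measurePreserving_piFinSuccAbove (fun _ : Fin (m + 1) => μ) 0
    set e := MeasurableEquiv.piFinSuccAbove (fun _ : Fin (m + 1) => Ω) 0
    have he : ∀ p, e.symm p = Fin.cons p.1 p.2 := fun p => by
      simp [e, MeasurableEquiv.piFinSuccAbove]
      rfl
    have hF : Measurable fun p => f (e.symm p) := hf.comp e.symm.measurable
    have h1 := hmp.symm.integral_comp' (fun S => Real.exp (l * f S))
    have h2 := hmp.symm.integral_comp' f
    rw [← h1, ← h2]
    have hint : Integrable (fun p => f (e.symm p)) (μ.prod (Measure.pi fun _ : Fin m => μ)) :=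
      integrable_of_abs_le hF fun p => hC _
    have hintexp := integrable_exp_of_abs_le
      (μ := μ.prod (Measure.pi fun _ : Fin m => μ)) hF (fun p => hC _) l
    rw [integral_prod _ hintexp, integral_prod _ hint]
    set g : Ω → ℝ := fun z => ∫ S, f (e.symm (z, S)) ∂(Measure.pi fun _ : Fin m => μ) with hg
    have hgm : Measurable g :=
      (hF.stronglyMeasurable.integral_prod_right (ν := Measure.pi fun _ : Fin m => μ)).measurable
    have hsec : ∀ z, Measurable fun S => f (e.symm (z, S)) := fun z =>
      hF.comp measurable_prodMk_left
    have hgosc : ∀ z z', |g z - g z'| ≤ c := by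
      intro z z'
      rw [hg]
      simp only
      rw [← integral_sub (integrable_of_abs_le (hsec z) fun p => hC _)
        (integrable_of_abs_le (hsec z') fun p => hC _)]
      have := norm_integral_le_of_norm_le_const (μ := Measure.pi fun _ : Fin m => μ)
        (f := fun S => f (e.symm (z, S)) - f (e.symm (z', S))) (C := c)
        (Filter.Eventually.of_forall fun S => by
          have := hd (e.symm (z, S)) 0 z'
          rw [he, he]
          rw [he, Fin.update_cons_zero] at this
          exact this)
      simpa using this
    have hgC : ∀ z, |g z| ≤ C := by
      intro z
      have := norm_integral_le_of_norm_le_const (μ := Measure.pi fun _ : Fin m => μ)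
        (f := fun S => f (e.symm (z, S))) (C := C)
        (Filter.Eventually.of_forall fun S => hC _)
      simpa using this
    have hstep : ∀ z, ∫ S, Real.exp (l * f (e.symm (z, S))) ∂(Measure.pi fun _ : Fin m => μ) ≤
        Real.exp (l * g z) * Real.exp (m * (l ^ 2 * c ^ 2 / 8)) := by
      intro z
      rw [← Real.exp_add]
      refine ih (fun S => f (e.symm (z, S))) (hsec z) ⟨C, fun S => hC _⟩ fun S i z' => ?_
      have := hd (e.symm (z, S)) i.succ z'
      simp only [he] at this ⊢
      rwa [← Fin.cons_update] at this
    calc _ ≤ ∫ z, Real.exp (l * g z) * Real.exp (m * (l ^ 2 * c ^ 2 / 8)) ∂μ := by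
          refine integral_mono hintexp.integral_prod_left ?_ hstep
          exact (integrable_exp_of_abs_le hgm hgC l).mul_const _
      _ = (∫ z, Real.exp (l * g z) ∂μ) * Real.exp (m * (l ^ 2 * c ^ 2 / 8)) :=
          integral_mul_const _ _
      _ ≤ Real.exp (l * (∫ z, g z ∂μ) + l ^ 2 * c ^ 2 / 8) * Real.exp (m * (l ^ 2 * c ^ 2 / 8)) :=
          mul_le_mul_of_nonneg_right (integral_exp_le_of_oscillation μ hgm hgosc l)
            (Real.exp_pos _).le
      _ = _ := by
          rw [← Real.exp_add]; congr 1; push_cast; ring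

/-- **McDiarmid's inequality** for a statistic of `m` independent points which changes by at most
`1 / m` when one of the points is changed. -/
theorem measure_ge_le_of_bounded_differences (μ : Measure Ω) [IsProbabilityMeasure μ] {m : ℕ}
    (hm : 0 < m) {f : (Fin m → Ω) → ℝ} (hf : Measurable f) {C : ℝ} (hC : ∀ S, |f S| ≤ C)
    (hd : ∀ S i z, |f S - f (Function.update S i z)| ≤ 1 / m) {s : ℝ} (hs : 0 ≤ s) :
    (Measure.pi fun _ : Fin m => μ).real
        {S | ∫ S', f S' ∂(Measure.pi fun _ => μ) + s ≤ f S} ≤ Real.exp (-2 * m * s ^ 2) := by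
  have hm' : (0 : ℝ) < m := by exact_mod_cast hm
  -- The minimizer of `l ^ 2 / (8 * m) - l * s`, with minimum `-2 * m * s ^ 2`.
  set l : ℝ := 4 * m * s
  have h := ProbabilityTheory.measure_ge_le_exp_mul_mgf (μ := Measure.pi fun _ : Fin m => μ)
    (X := f) (t := l) (∫ S', f S' ∂(Measure.pi fun _ => μ) + s) (by positivity)
    (integrable_exp_of_abs_le hf hC l)
  refine h.trans ?_
  have h2 := integral_exp_le_of_bounded_differences μ (1 / m) l m f hf ⟨C, hC⟩ hd
  refine (mul_le_mul_of_nonneg_left h2 (Real.exp_pos _).le).trans (le_of_eq ?_)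
  rw [← Real.exp_add]
  congr 1
  simp only [l]
  field_simp
  ring

end BoundedDifferences

/-! ### Rademacher averages: symmetry, contraction, finite maxima. -/

section Rademacher

/-- The sum over all sign vectors `ε` of the supremum of `∑ k, ε k * v i k` over `i`: the
Rademacher complexity of the family of vectors `v`, multiplied by `m * 2 ^ m`. -/
noncomputable def signSum {ι : Type*} {m : ℕ} (v : ι → Fin m → ℝ) : ℝ :=
  ∑ ε : Fin m → ℤˣ, ⨆ i, ∑ k, ((ε k : ℤ) : ℝ) * v i k

/-- The variant of `signSum` with absolute values. -/
noncomputable def signAbsSum {ι : Type*} {m : ℕ} (v : ι → Fin m → ℝ) : ℝ :=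
  ∑ ε : Fin m → ℤˣ, ⨆ i, |∑ k, ((ε k : ℤ) : ℝ) * v i k|

lemma abs_sign (e : ℤˣ) : |((e : ℤ) : ℝ)| = 1 := by
  rcases Int.units_eq_one_or e with h | h <;> simp [h]

variable {ι : Type*} {m : ℕ}

lemma abs_sum_sign_mul_le {v : Fin m → ℝ} {C : ℝ} (hC : ∀ k, |v k| ≤ C) (ε : Fin m → ℤˣ) :
    |∑ k, ((ε k : ℤ) : ℝ) * v k| ≤ m * C := by
  refine (Finset.abs_sum_le_sum_abs _ _).trans ?_
  have : ∀ k ∈ Finset.univ, |((ε k : ℤ) : ℝ) * v k| ≤ C := fun k _ => by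
    rw [abs_mul, abs_sign, one_mul]; exact hC k
  simpa using Finset.sum_le_sum this

lemma bddAbove_abs_sum_sign_mul {v : ι → Fin m → ℝ} {C : ℝ} (hC : ∀ i k, |v i k| ≤ C)
    (ε : Fin m → ℤˣ) : BddAbove (Set.range fun i => |∑ k, ((ε k : ℤ) : ℝ) * v i k|) := by
  refine ⟨m * C, ?_⟩
  rintro _ ⟨i, rfl⟩
  exact abs_sum_sign_mul_le (hC i) ε

lemma bddAbove_sum_sign_mul {v : ι → Fin m → ℝ} {C : ℝ} (hC : ∀ i k, |v i k| ≤ C)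
    (ε : Fin m → ℤˣ) : BddAbove (Set.range fun i => ∑ k, ((ε k : ℤ) : ℝ) * v i k) := by
  refine ⟨m * C, ?_⟩
  rintro _ ⟨i, rfl⟩
  exact (le_abs_self _).trans (abs_sum_sign_mul_le (hC i) ε)

lemma signSum_le_signAbsSum [Nonempty ι] {v : ι → Fin m → ℝ} {C : ℝ} (hC : ∀ i k, |v i k| ≤ C) :
    signSum v ≤ signAbsSum v :=
  Finset.sum_le_sum fun ε _ =>
    ciSup_mono (bddAbove_abs_sum_sign_mul hC ε) fun _ => le_abs_self _

/-- Since the zero vector belongs to the family, all suprema are nonnegative, so the absolute value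
is at most the supremum at `ε` plus the one at `-ε`. Negation permutes the sign vectors, whence the
factor 2. -/
lemma signAbsSum_le_two_mul_signSum {v : ι → Fin m → ℝ} {C : ℝ} (hC : ∀ i k, |v i k| ≤ C)
    (i₀ : ι) (h₀ : ∀ k, v i₀ k = 0) : signAbsSum v ≤ 2 * signSum v := by
  have : Nonempty ι := ⟨i₀⟩
  have hneg : ∑ ε : Fin m → ℤˣ, (⨆ i, ∑ k, (((-ε) k : ℤ) : ℝ) * v i k) = signSum v :=
    Equiv.sum_comp (Equiv.neg (Fin m → ℤˣ)) fun ε => ⨆ i, ∑ k, ((ε k : ℤ) : ℝ) * v i k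
  have hpos : ∀ ε : Fin m → ℤˣ, 0 ≤ ⨆ i, ∑ k, ((ε k : ℤ) : ℝ) * v i k := fun ε => by
    refine le_ciSup_of_le (bddAbove_sum_sign_mul hC ε) i₀ ?_
    simp [h₀]
  rw [two_mul]
  nth_rewrite 2 [← hneg]
  rw [signSum, signAbsSum, ← Finset.sum_add_distrib]
  refine Finset.sum_le_sum fun ε _ => ciSup_le fun i => ?_
  have h1 := le_ciSup (bddAbove_sum_sign_mul hC ε) i
  have h2 := le_ciSup (bddAbove_sum_sign_mul hC (-ε)) i
  have e : ∑ k, (((-ε) k : ℤ) : ℝ) * v i k = -∑ k, ((ε k : ℤ) : ℝ) * v i k := by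
    rw [← Finset.sum_neg_distrib]
    exact Finset.sum_congr rfl fun k _ => by simp
  rw [abs_le']
  simp only [e] at h2
  constructor
  · linarith [hpos (-ε)]
  · linarith [hpos ε]

/-- For indices `i`, `j` the left side is `a i + a j + (b' i - b' j)`, at most `a i + a j + |b i - b
j|`. The sign of `b i - b j` decides which index is tested in which supremum on the right. -/
lemma ciSup_add_ciSup_sub_le [Nonempty ι] {a b b' : ι → ℝ}
    (h1 : BddAbove (Set.range fun i => a i + b i)) (h2 : BddAbove (Set.range fun i => a i - b i))
    (hb : ∀ i j, |b' i - b' j| ≤ |b i - b j|) :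
    (⨆ i, (a i + b' i)) + (⨆ i, (a i - b' i)) ≤ (⨆ i, (a i + b i)) + ⨆ i, (a i - b i) := by
  rw [← le_sub_iff_add_le]
  refine ciSup_le fun i => ?_
  rw [le_sub_comm]
  refine ciSup_le fun j => ?_
  have hij := (le_abs_self _).trans (hb i j)
  have e1 := le_ciSup h1 i
  have e2 := le_ciSup h2 j
  have e3 := le_ciSup h1 j
  have e4 := le_ciSup h2 i
  rcases abs_cases (b i - b j) with h | h <;> linarith [h.1]

/-- Pairing each `ε` with its flip at `j` leaves the other terms fixed and turns the claim into
`ciSup_add_ciSup_sub_le`. -/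
lemma signSum_le_of_coordinate [Nonempty ι] {v v' : ι → Fin m → ℝ} {C : ℝ}
    (hC : ∀ i k, |v i k| ≤ C) (j : Fin m) (h : ∀ i k, k ≠ j → v' i k = v i k)
    (hj : ∀ i i', |v' i j - v' i' j| ≤ |v i j - v i' j|) : signSum v' ≤ signSum v := by
  classical
  let flip : Equiv.Perm (Fin m → ℤˣ) := Equiv.mulLeft (Pi.mulSingle j (-1))
  have hdouble : ∀ u : ι → Fin m → ℝ, 2 * signSum u = ∑ ε : Fin m → ℤˣ,
      ((⨆ i, ∑ k, ((ε k : ℤ) : ℝ) * u i k) + ⨆ i, ∑ k, ((flip ε k : ℤ) : ℝ) * u i k) := by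
    intro u
    rw [two_mul, Finset.sum_add_distrib,
      Equiv.sum_comp flip fun ε => ⨆ i, ∑ k, ((ε k : ℤ) : ℝ) * u i k]
    rfl
  have hsplit : ∀ (u : ι → Fin m → ℝ) (ε : Fin m → ℤˣ) (i : ι),
      ∑ k, ((ε k : ℤ) : ℝ) * u i k =
        ∑ k ∈ Finset.univ.erase j, ((ε k : ℤ) : ℝ) * u i k + ((ε j : ℤ) : ℝ) * u i j :=
    fun u ε i => (Finset.sum_erase_add _ _ (Finset.mem_univ j)).symm
  have hflip : ∀ (u : ι → Fin m → ℝ) (ε : Fin m → ℤˣ) (i : ι),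
      ∑ k, ((flip ε k : ℤ) : ℝ) * u i k =
        ∑ k ∈ Finset.univ.erase j, ((ε k : ℤ) : ℝ) * u i k - ((ε j : ℤ) : ℝ) * u i j := by
    intro u ε i
    rw [hsplit, sub_eq_add_neg]
    congr 1
    · refine Finset.sum_congr rfl fun k hk => ?_
      have : k ≠ j := (Finset.mem_erase.1 hk).1
      simp [flip, Pi.mulSingle_eq_of_ne this]
    · simp [flip]
  have hsame : ∀ (ε : Fin m → ℤˣ) (i : ι), ∑ k ∈ Finset.univ.erase j, ((ε k : ℤ) : ℝ) * v' i k =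
      ∑ k ∈ Finset.univ.erase j, ((ε k : ℤ) : ℝ) * v i k := fun ε i =>
    Finset.sum_congr rfl fun k hk => by rw [h i k (Finset.mem_erase.1 hk).1]
  have key : 2 * signSum v' ≤ 2 * signSum v := by
    rw [hdouble, hdouble]
    refine Finset.sum_le_sum fun ε _ => ?_
    have b1 := bddAbove_sum_sign_mul hC ε
    have b2 := bddAbove_sum_sign_mul hC (flip ε)
    simp only [hflip] at b2 ⊢
    simp only [hsplit _ ε] at b1 ⊢
    simp only [hsame]
    refine ciSup_add_ciSup_sub_le b1 b2 fun i i' => ?_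
    rw [← mul_sub, ← mul_sub, abs_mul, abs_mul, abs_sign, one_mul, one_mul]
    exact hj i i'
  linarith

/-- **Talagrand's contraction lemma.** -/
theorem signSum_contraction [Nonempty ι] {v : ι → Fin m → ℝ} {C : ℝ}
    (hC : ∀ i k, |v i k| ≤ C) {φ : Fin m → ℝ → ℝ} (hφ : ∀ k x y, |φ k x - φ k y| ≤ |x - y|) :
    signSum (fun i k => φ k (v i k)) ≤ signSum v := by
  classical
  obtain ⟨K, hK⟩ : ∃ K, ∀ k, |φ k 0| ≤ K := by
    obtain ⟨K, hK⟩ := (Set.finite_range fun k => |φ k 0|).bddAbove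
    exact ⟨K, fun k => hK ⟨k, rfl⟩⟩
  have hb : ∀ (s : Finset (Fin m)) i k, |if k ∈ s then φ k (v i k) else v i k| ≤ C + |K| := by
    intro s i k
    have h1 := hC i k
    split_ifs
    · have h2 := hφ k (v i k) 0
      have h3 := abs_sub_abs_le_abs_sub (φ k (v i k)) (φ k 0)
      rw [sub_zero] at h2
      linarith [hK k, le_abs_self K]
    · linarith [abs_nonneg K]
  -- The maps are applied to one coordinate at a time; `s` collects the coordinates already treated.
  have main : ∀ s : Finset (Fin m),
      signSum (fun i k => if k ∈ s then φ k (v i k) else v i k) ≤ signSum v := by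
    intro s
    induction s using Finset.induction_on with
    | empty => simp
    | insert j s hjs ih =>
      refine (signSum_le_of_coordinate (hb s) j (fun i k hk => ?_) fun i i' => ?_).trans ih
      · simp [hk]
      · simpa [hjs] using hφ j (v i j) (v i' j)
  simpa using main Finset.univ

lemma sum_exp_sum_sign_mul (z : Fin m → ℝ) :
    ∑ ε : Fin m → ℤˣ, Real.exp (∑ k, ((ε k : ℤ) : ℝ) * z k) =
      2 ^ m * ∏ k, Real.cosh (z k) := by
  have h := Finset.prod_univ_sum (fun _ : Fin m => (Finset.univ : Finset ℤˣ))
    fun k e => Real.exp (((e : ℤ) : ℝ) * z k)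
  simp_rw [Real.exp_sum]
  rw [Fintype.piFinset_univ] at h
  rw [← h]
  have e : ∀ k, ∑ e : ℤˣ, Real.exp (((e : ℤ) : ℝ) * z k) = 2 * Real.cosh (z k) := by
    intro k
    rw [Real.cosh_eq, UnitsInt.univ]
    simp
    ring
  simp_rw [e, Finset.prod_mul_distrib]
  simp

lemma sum_exp_sum_sign_mul_le {z : Fin m → ℝ} {Z : ℝ} (hz : ∀ k, |z k| ≤ Z) (l : ℝ) :
    ∑ ε : Fin m → ℤˣ, Real.exp (l * ∑ k, ((ε k : ℤ) : ℝ) * z k) ≤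
      2 ^ m * Real.exp (m * (l ^ 2 * Z ^ 2 / 2)) := by
  have e : ∀ ε : Fin m → ℤˣ, l * ∑ k, ((ε k : ℤ) : ℝ) * z k =
      ∑ k, ((ε k : ℤ) : ℝ) * (l * z k) := fun ε => by
    rw [Finset.mul_sum]; exact Finset.sum_congr rfl fun k _ => by ring
  simp_rw [e, sum_exp_sum_sign_mul]
  refine mul_le_mul_of_nonneg_left ?_ (by positivity)
  calc ∏ k, Real.cosh (l * z k) ≤ ∏ _k : Fin m, Real.exp (l ^ 2 * Z ^ 2 / 2) := by
        refine Finset.prod_le_prod (fun k _ => (Real.cosh_pos _).le) fun k _ => ?_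
        refine (Real.cosh_le_exp_half_sq _).trans (Real.exp_le_exp.2 ?_)
        have := sq_le_sq' (abs_le.1 (hz k)).1 (abs_le.1 (hz k)).2
        rw [mul_pow]
        gcongr
    _ = _ := by simp [← Real.exp_nat_mul]

/-- **Massart's lemma** for the `n` coordinates of `m` points. -/
theorem signAbsSum_coordinates_le {n : ℕ} (hn : 0 < n) (hm : 0 < m) {z : Fin m → Fin n → ℝ}
    {Z : ℝ} (hz : ∀ k j, |z k j| ≤ Z) :
    signAbsSum (fun j k => z k j) ≤ 2 ^ m * (Z * Real.sqrt (2 * m * Real.log (2 * n))) := by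
  have hn' : (1 : ℝ) ≤ n := by exact_mod_cast hn
  have hm' : (0 : ℝ) < m := by exact_mod_cast hm
  have hne : Nonempty (Fin n) := ⟨⟨0, hn⟩⟩
  have hlog : 0 < Real.log (2 * n) := Real.log_pos (by linarith)
  have hZ0 : 0 ≤ Z := (abs_nonneg _).trans (hz ⟨0, hm⟩ ⟨0, hn⟩)
  rcases hZ0.eq_or_lt with rfl | hZ
  · have h0 : ∀ k j, z k j = 0 := fun k j => abs_eq_zero.1 (le_antisymm (hz k j) (abs_nonneg _))
    simp [signAbsSum, h0]
  set L := Real.sqrt (2 * m * Real.log (2 * n)) with hL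
  have hLpos : 0 < L := Real.sqrt_pos.2 (by positivity)
  have hL2 : L ^ 2 = 2 * m * Real.log (2 * n) := Real.sq_sqrt (by positivity)
  -- The optimal exponent: it makes the two terms `log (2n)` and `m l² Z² / 2` equal.
  set l : ℝ := L / (m * Z) with hl
  have hlpos : 0 < l := by positivity
  set N : (Fin m → ℤˣ) → ℝ := fun ε => ⨆ j, |∑ k, ((ε k : ℤ) : ℝ) * z k j| with hN
  -- A maximum of absolute values is a maximum over `2n` signed sums; this is the origin of `log
  -- (2n)`.
  have hexp : ∀ ε, Real.exp (l * N ε) ≤ ∑ j, (Real.exp (l * ∑ k, ((ε k : ℤ) : ℝ) * z k j) +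
      Real.exp (-l * ∑ k, ((ε k : ℤ) : ℝ) * z k j)) := by
    intro ε
    obtain ⟨j, hj⟩ := exists_eq_ciSup_of_finite (f := fun j => |∑ k, ((ε k : ℤ) : ℝ) * z k j|)
    rw [hN]
    simp only
    rw [← hj]
    refine le_trans ?_ (Finset.single_le_sum (f := fun j =>
      Real.exp (l * ∑ k, ((ε k : ℤ) : ℝ) * z k j) + Real.exp (-l * ∑ k, ((ε k : ℤ) : ℝ) * z k j))
      (fun i _ => by positivity) (Finset.mem_univ j))
    have p1 := Real.exp_pos (l * ∑ k, ((ε k : ℤ) : ℝ) * z k j)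
    have p2 := Real.exp_pos (-l * ∑ k, ((ε k : ℤ) : ℝ) * z k j)
    rcases abs_choice (∑ k, ((ε k : ℤ) : ℝ) * z k j) with h | h <;> rw [h]
    · linarith
    · rw [mul_neg, ← neg_mul]; linarith
  have hsum : ∑ ε, Real.exp (l * N ε) ≤ 2 ^ m * (2 * n * Real.exp (m * (l ^ 2 * Z ^ 2 / 2))) := by
    refine (Finset.sum_le_sum fun ε _ => hexp ε).trans ?_
    rw [Finset.sum_comm]
    have : ∀ j ∈ (Finset.univ : Finset (Fin n)), ∑ ε : Fin m → ℤˣ,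
        (Real.exp (l * ∑ k, ((ε k : ℤ) : ℝ) * z k j) +
          Real.exp (-l * ∑ k, ((ε k : ℤ) : ℝ) * z k j)) ≤
        2 * (2 ^ m * Real.exp (m * (l ^ 2 * Z ^ 2 / 2))) := by
      intro j _
      rw [Finset.sum_add_distrib]
      have h1 := sum_exp_sum_sign_mul_le (fun k => hz k j) l
      have h2 := sum_exp_sum_sign_mul_le (fun k => hz k j) (-l)
      rw [neg_sq] at h2
      linarith
    refine (Finset.sum_le_sum this).trans (le_of_eq ?_)
    simp
    ring
  have hjensen : Real.exp (l * ((∑ ε, N ε) / 2 ^ m)) ≤ (∑ ε, Real.exp (l * N ε)) / 2 ^ m := by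
    have := convexOn_exp.map_sum_le (t := Finset.univ) (w := fun _ : Fin m → ℤˣ => (1 : ℝ) / 2 ^ m)
      (p := fun ε => l * N ε) (fun _ _ => by positivity) (by simp) (fun _ _ => Set.mem_univ _)
    simp only [smul_eq_mul, ← Finset.mul_sum] at this
    rw [mul_left_comm, one_div, ← div_eq_inv_mul, ← div_eq_inv_mul] at this
    exact this
  have hfin : Real.exp (l * ((∑ ε, N ε) / 2 ^ m)) ≤
      Real.exp (Real.log (2 * n) + m * (l ^ 2 * Z ^ 2 / 2)) := by
    rw [Real.exp_add, Real.exp_log (by positivity)]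
    refine hjensen.trans ?_
    rw [div_le_iff₀ (by positivity)]
    linarith
  have h3 := Real.exp_le_exp.1 hfin
  have h4 : Real.log (2 * n) + m * (l ^ 2 * Z ^ 2 / 2) = l * (Z * L) := by
    have : Real.log (2 * n) = L ^ 2 / (2 * m) := by rw [hL2]; field_simp
    rw [this, hl]
    field_simp
    ring
  rw [h4] at h3
  have h5 := le_of_mul_le_mul_left h3 hlpos
  rw [div_le_iff₀ (by positivity)] at h5
  change ∑ ε, N ε ≤ _
  linarith

end Rademacher

/-! ### Rademacher complexity of the modules and of the network. -/

section Layers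

variable {n : ℕ} {σ : ℕ → ℝ → ℝ} {lam : ℕ → ℝ}

lemma abs_le_of_lipschitz {g : ℝ → ℝ} (hg : LipschitzWith 1 g) (h0 : g 0 = 0) (y : ℝ) :
    |g y| ≤ |y| := by
  have := hg.dist_le_mul y 0
  simpa [Real.dist_eq, h0] using this

lemma abs_sum_mul_le {ι : Type*} [Fintype ι] {u v : ι → ℝ} {V : ℝ} (hv : ∀ i, |v i| ≤ V) :
    |∑ i, u i * v i| ≤ (∑ i, |u i|) * V := by
  refine (Finset.abs_sum_le_sum_abs _ _).trans ?_
  rw [Finset.sum_mul]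
  refine Finset.sum_le_sum fun i _ => ?_
  rw [abs_mul]
  exact mul_le_mul_of_nonneg_left (hv i) (abs_nonneg _)

lemma zero_mem_unitFamily (hlam : ∀ t, 0 ≤ lam t) (t : ℕ) :
    (fun _ => 0) ∈ unitFamily n σ lam t := by
  induction t with
  | zero => exact ⟨0, by simpa using hlam 0, by simp⟩
  | succ t ih => exact ⟨0, by simpa using hlam (t + 1), fun _ _ => 0, fun _ => ih, by simp⟩

lemma continuous_of_mem_unitFamily (hσ : ∀ t, LipschitzWith 1 (σ t)) (t : ℕ) :
    ∀ h ∈ unitFamily n σ lam t, Continuous h := by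
  induction t with
  | zero =>
    rintro _ ⟨u, -, rfl⟩
    have := (hσ 0).continuous
    fun_prop
  | succ t ih =>
    rintro _ ⟨u, -, f, hf, rfl⟩
    have := (hσ (t + 1)).continuous
    have := fun i => ih (f i) (hf i)
    fun_prop

lemma abs_le_of_mem_unitFamily (hσ : ∀ t, LipschitzWith 1 (σ t)) (hσ0 : ∀ t, σ t 0 = 0)
    (hlam : ∀ t, 0 ≤ lam t) (t : ℕ) : ∀ h ∈ unitFamily n σ lam t, ∀ x,
      |h x| ≤ (∏ s ∈ Finset.range (t + 1), lam s) * ‖x‖ := by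
  induction t with
  | zero =>
    rintro _ ⟨u, hu, rfl⟩ x
    refine (abs_sum_mul_le (V := ‖x‖) fun i => ?_).trans ?_
    · exact (abs_le_of_lipschitz (hσ 0) (hσ0 0) _).trans (norm_le_pi_norm x i)
    · simpa using mul_le_mul_of_nonneg_right hu (norm_nonneg x)
  | succ t ih =>
    rintro _ ⟨u, hu, f, hf, rfl⟩ x
    refine (abs_sum_mul_le (V := (∏ s ∈ Finset.range (t + 1), lam s) * ‖x‖) fun i => ?_).trans ?_
    · exact (abs_le_of_lipschitz (hσ _) (hσ0 _) _).trans (ih (f i) (hf i) x)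
    · rw [Finset.prod_range_succ _ (t + 1), mul_comm _ (lam (t + 1)), mul_assoc]
      refine mul_le_mul_of_nonneg_right hu (mul_nonneg ?_ (norm_nonneg x))
      exact Finset.prod_nonneg fun s _ => hlam s

variable {m : ℕ}

/-- The vectors of values at the points `x` of the functions in a family. -/
def sampleVectors {X : Type*} (F : Set (X → ℝ)) (x : Fin m → X) : F → Fin m → ℝ :=
  fun h k => h.1 (x k)

lemma abs_sampleVectors_unitFamily_le (hσ : ∀ t, LipschitzWith 1 (σ t)) (hσ0 : ∀ t, σ t 0 = 0)
    (hlam : ∀ t, 0 ≤ lam t) {x : Fin m → Fin n → ℝ} {Z : ℝ} (hx : ∀ k, ‖x k‖ ≤ Z) (t : ℕ) :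
    ∀ i k, |sampleVectors (unitFamily n σ lam t) x i k| ≤
      (∏ s ∈ Finset.range (t + 1), lam s) * Z := by
  intro i k
  refine (abs_le_of_mem_unitFamily hσ hσ0 hlam t i.1 i.2 (x k)).trans ?_
  exact mul_le_mul_of_nonneg_left (hx k) (Finset.prod_nonneg fun s _ => hlam s)

lemma sum_sign_mul_sum (ε : Fin m → ℤˣ) (u : Fin n → ℝ) (v : Fin n → Fin m → ℝ) :
    ∑ k, ((ε k : ℤ) : ℝ) * ∑ i, u i * v i k =
      ∑ i, u i * ∑ k, ((ε k : ℤ) : ℝ) * v i k := by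
  simp_rw [Finset.mul_sum]
  rw [Finset.sum_comm]
  exact Finset.sum_congr rfl fun i _ => Finset.sum_congr rfl fun k _ => by ring

lemma signAbsSum_unitFamily_zero_le (hn : 0 < n) (hlam : ∀ t, 0 ≤ lam t)
    (hσ : ∀ t, LipschitzWith 1 (σ t)) (hσ0 : ∀ t, σ t 0 = 0)
    (hm : 0 < m) {x : Fin m → Fin n → ℝ} {Z : ℝ} (hx : ∀ k, ‖x k‖ ≤ Z) :
    signAbsSum (sampleVectors (unitFamily n σ lam 0) x) ≤
      lam 0 * (2 ^ m * (Z * Real.sqrt (2 * m * Real.log (2 * n)))) := by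
  have hz : ∀ k j, |σ 0 (x k j)| ≤ Z := fun k j =>
    (abs_le_of_lipschitz (hσ 0) (hσ0 0) _).trans ((norm_le_pi_norm (x k) j).trans (hx k))
  refine le_trans ?_ (mul_le_mul_of_nonneg_left (signAbsSum_coordinates_le hn hm hz) (hlam 0))
  rw [signAbsSum, signAbsSum, Finset.mul_sum]
  refine Finset.sum_le_sum fun ε _ => ?_
  have : Nonempty (unitFamily n σ lam 0) := ⟨⟨_, zero_mem_unitFamily hlam 0⟩⟩
  refine ciSup_le ?_
  rintro ⟨_, u, hu, rfl⟩
  simp only [sampleVectors]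
  rw [sum_sign_mul_sum ε u fun i k => σ 0 (x k i)]
  have hbdd := bddAbove_abs_sum_sign_mul (v := fun j k => σ 0 (x k j)) (fun j k => hz k j) ε
  refine (abs_sum_mul_le fun i => le_ciSup hbdd i).trans ?_
  refine mul_le_mul_of_nonneg_right hu ?_
  exact Real.iSup_nonneg fun i => abs_nonneg _

/-- By `ℓ₁`–`ℓ∞` duality the outer weights contribute `lam (t + 1)` when absolute values are kept
inside the supremum. Contraction is only available without absolute values, so the activation is
removed by passing through `signSum`, at the price of a factor 2. -/
lemma signAbsSum_unitFamily_succ_le (hlam : ∀ t, 0 ≤ lam t)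
    (hσ : ∀ t, LipschitzWith 1 (σ t)) (hσ0 : ∀ t, σ t 0 = 0)
    {x : Fin m → Fin n → ℝ} {Z : ℝ} (hx : ∀ k, ‖x k‖ ≤ Z) (t : ℕ) :
    signAbsSum (sampleVectors (unitFamily n σ lam (t + 1)) x) ≤
      2 * lam (t + 1) * signAbsSum (sampleVectors (unitFamily n σ lam t) x) := by
  set v := sampleVectors (unitFamily n σ lam t) x with hv
  have hC := abs_sampleVectors_unitFamily_le hσ hσ0 hlam hx t
  rw [← hv] at hC
  have : Nonempty (unitFamily n σ lam t) := ⟨⟨_, zero_mem_unitFamily hlam t⟩⟩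
  have hC' : ∀ i k, |σ (t + 1) (v i k)| ≤ (∏ s ∈ Finset.range (t + 1), lam s) * Z := fun i k =>
    (abs_le_of_lipschitz (hσ _) (hσ0 _) _).trans (hC i k)
  have h1 : signAbsSum (sampleVectors (unitFamily n σ lam (t + 1)) x) ≤
      lam (t + 1) * signAbsSum fun i k => σ (t + 1) (v i k) := by
    rw [signAbsSum, signAbsSum, Finset.mul_sum]
    refine Finset.sum_le_sum fun ε _ => ?_
    have : Nonempty (unitFamily n σ lam (t + 1)) := ⟨⟨_, zero_mem_unitFamily hlam (t + 1)⟩⟩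
    refine ciSup_le ?_
    rintro ⟨_, u, hu, f, hf, rfl⟩
    simp only [sampleVectors]
    rw [sum_sign_mul_sum ε u fun i k => σ (t + 1) (f i (x k))]
    refine (abs_sum_mul_le fun i =>
      le_ciSup (bddAbove_abs_sum_sign_mul hC' ε) ⟨f i, hf i⟩).trans ?_
    refine mul_le_mul_of_nonneg_right hu ?_
    exact Real.iSup_nonneg fun i => abs_nonneg _
  have h2 : signAbsSum (fun i k => σ (t + 1) (v i k)) ≤
      2 * signSum fun i k => σ (t + 1) (v i k) :=
    signAbsSum_le_two_mul_signSum hC' ⟨_, zero_mem_unitFamily hlam t⟩ fun k => hσ0 (t + 1)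
  have h3 : signSum (fun i k => σ (t + 1) (v i k)) ≤ signSum v :=
    signSum_contraction hC (φ := fun _ => σ (t + 1)) fun _ y y' => by
      simpa [Real.dist_eq] using (hσ (t + 1)).dist_le_mul y y'
  have h4 := signSum_le_signAbsSum hC
  have h5 := mul_le_mul_of_nonneg_left (h2.trans (mul_le_mul_of_nonneg_left (h3.trans h4)
    zero_le_two)) (hlam (t + 1))
  linarith

lemma weightProd_nonneg (hlam : ∀ t, 0 ≤ lam t) (t : ℕ) : 0 ≤ weightProd lam t :=
  Finset.prod_nonneg fun s _ => mul_nonneg zero_le_two (hlam s)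

theorem signAbsSum_unitFamily_le (hn : 0 < n) (hlam : ∀ t, 0 ≤ lam t)
    (hσ : ∀ t, LipschitzWith 1 (σ t)) (hσ0 : ∀ t, σ t 0 = 0)
    (hm : 0 < m) {x : Fin m → Fin n → ℝ} {Z : ℝ} (hx : ∀ k, ‖x k‖ ≤ Z) (t : ℕ) :
    signAbsSum (sampleVectors (unitFamily n σ lam t) x) ≤
      weightProd lam t * (2 ^ m * m * (Z * Real.sqrt (Real.log (2 * n) / (2 * m)))) := by
  have hm' : (0 : ℝ) < m := by exact_mod_cast hm
  induction t with
  | zero =>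
    refine (signAbsSum_unitFamily_zero_le hn hlam hσ hσ0 hm hx).trans (le_of_eq ?_)
    -- At level 0 no contraction factor occurs; the 2 in `weightProd` is the one released by
    -- rewriting Massart's root.
    have : Real.sqrt (2 * m * Real.log (2 * n)) =
        2 * m * Real.sqrt (Real.log (2 * n) / (2 * m)) := by
      have e : 2 * m * Real.log (2 * n) = (2 * m) ^ 2 * (Real.log (2 * n) / (2 * m)) := by
        field_simp
      rw [e, Real.sqrt_mul (by positivity), Real.sqrt_sq (by positivity)]
    rw [this]
    simp [weightProd]
    ring
  | succ t ih =>
    refine (signAbsSum_unitFamily_succ_le hlam hσ hσ0 hx t).trans ?_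
    refine (mul_le_mul_of_nonneg_left ih (mul_nonneg zero_le_two (hlam (t + 1)))).trans
      (le_of_eq ?_)
    rw [weightProd, weightProd, Finset.prod_range_succ _ (t + 1)]
    ring

/-- The network functions with modules from the families `unitFamily n σ lam t` and output weights
of `ℓ₁` norm at most `a`. -/
def netFamily (n T : ℕ) (σ : ℕ → ℝ → ℝ) (lam : ℕ → ℝ) (a : ℝ) : Set ((Fin n → ℝ) → ℝ) :=
  {F | ∃ w : Fin n → ℝ, ∑ j, |w j| ≤ a ∧ ∃ f : ℕ → Fin n → (Fin n → ℝ) → ℝ,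
    (∀ t ≤ T, ∀ j, f t j ∈ unitFamily n σ lam t) ∧ F = resNet T w f}

variable {T : ℕ} {a : ℝ}

lemma zero_mem_netFamily (hlam : ∀ t, 0 ≤ lam t) (ha : 0 ≤ a) :
    (fun _ => 0) ∈ netFamily n T σ lam a :=
  ⟨0, by simpa using ha, fun _ _ _ => 0, fun t _ _ => zero_mem_unitFamily hlam t, by
    funext x; simp [resNet]⟩

lemma continuous_of_mem_netFamily (hσ : ∀ t, LipschitzWith 1 (σ t)) :
    ∀ F ∈ netFamily n T σ lam a, Continuous F := by
  rintro _ ⟨w, -, f, hf, rfl⟩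
  unfold resNet
  refine continuous_finsetSum _ fun j _ => continuous_const.mul ?_
  refine continuous_finsetSum _ fun t ht => ?_
  exact continuous_of_mem_unitFamily hσ t _ (hf t (Nat.lt_succ_iff.1 (Finset.mem_range.1 ht)) j)

lemma abs_le_of_mem_netFamily (hσ : ∀ t, LipschitzWith 1 (σ t)) (hσ0 : ∀ t, σ t 0 = 0)
    (hlam : ∀ t, 0 ≤ lam t) : ∀ F ∈ netFamily n T σ lam a, ∀ x,
      |F x| ≤ a * ((∑ t ∈ Finset.range (T + 1), ∏ s ∈ Finset.range (t + 1), lam s) * ‖x‖) := by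
  rintro _ ⟨w, hw, f, hf, rfl⟩ x
  refine (abs_sum_mul_le (V := (∑ t ∈ Finset.range (T + 1),
    ∏ s ∈ Finset.range (t + 1), lam s) * ‖x‖) fun j => ?_).trans ?_
  · rw [Finset.sum_mul]
    refine (Finset.abs_sum_le_sum_abs _ _).trans (Finset.sum_le_sum fun t ht => ?_)
    exact abs_le_of_mem_unitFamily hσ hσ0 hlam t _
      (hf t (Nat.lt_succ_iff.1 (Finset.mem_range.1 ht)) j) x
  · refine mul_le_mul_of_nonneg_right hw (mul_nonneg ?_ (norm_nonneg x))
    exact Finset.sum_nonneg fun t _ => Finset.prod_nonneg fun s _ => hlam s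

theorem signSum_netFamily_le (hn : 0 < n) (hlam : ∀ t, 0 ≤ lam t)
    (hσ : ∀ t, LipschitzWith 1 (σ t)) (hσ0 : ∀ t, σ t 0 = 0)
    (hm : 0 < m) {x : Fin m → Fin n → ℝ} {Z : ℝ} (hx : ∀ k, ‖x k‖ ≤ Z) (ha : 0 ≤ a) :
    signSum (sampleVectors (netFamily n T σ lam a) x) ≤
      a * ((∑ t ∈ Finset.range (T + 1), weightProd lam t) *
        (2 ^ m * m * (Z * Real.sqrt (Real.log (2 * n) / (2 * m))))) := by
  have h1 : signSum (sampleVectors (netFamily n T σ lam a) x) ≤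
      a * ∑ t ∈ Finset.range (T + 1), signAbsSum (sampleVectors (unitFamily n σ lam t) x) := by
    simp only [signSum, signAbsSum]
    rw [Finset.sum_comm, Finset.mul_sum]
    refine Finset.sum_le_sum fun ε _ => ?_
    have : Nonempty (netFamily n T σ lam a) := ⟨⟨_, zero_mem_netFamily hlam ha⟩⟩
    refine ciSup_le ?_
    rintro ⟨_, w, hw, f, hf, rfl⟩
    simp only [sampleVectors, resNet]
    rw [sum_sign_mul_sum ε w fun j k => ∑ t ∈ Finset.range (T + 1), f t j (x k)]
    have hin : ∀ j, |∑ k, ((ε k : ℤ) : ℝ) * ∑ t ∈ Finset.range (T + 1), f t j (x k)| ≤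
        ∑ t ∈ Finset.range (T + 1), ⨆ i : unitFamily n σ lam t,
          |∑ k, ((ε k : ℤ) : ℝ) * sampleVectors (unitFamily n σ lam t) x i k| := by
      intro j
      simp_rw [Finset.mul_sum]
      rw [Finset.sum_comm]
      refine (Finset.abs_sum_le_sum_abs _ _).trans (Finset.sum_le_sum fun t ht => ?_)
      exact le_ciSup (bddAbove_abs_sum_sign_mul
        (abs_sampleVectors_unitFamily_le hσ hσ0 hlam hx t) ε)
        ⟨f t j, hf t (Nat.lt_succ_iff.1 (Finset.mem_range.1 ht)) j⟩
    refine (le_abs_self _).trans ((abs_sum_mul_le hin).trans ?_)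
    refine mul_le_mul_of_nonneg_right hw (Finset.sum_nonneg fun t _ => ?_)
    exact Real.iSup_nonneg fun i => abs_nonneg _
  refine h1.trans (mul_le_mul_of_nonneg_left ?_ ha)
  rw [Finset.sum_mul]
  exact Finset.sum_le_sum fun t _ => signAbsSum_unitFamily_le hn hlam hσ hσ0 hm hx t

end Layers

/-! ### Symmetrization with a ghost sample. -/

section Symmetrization

variable {Ω : Type*} [MeasurableSpace Ω] {ι : Type*} {m : ℕ}

/-- The largest excess over `i` of the expectation of `ψ i` over its empirical mean. -/
noncomputable def uniformDeviation (μ : Measure Ω) (ψ : ι → Ω → ℝ) (S : Fin m → Ω) : ℝ :=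
  ⨆ i, (∫ z, ψ i z ∂μ - (∑ k, ψ i (S k)) / m)

lemma sum_div_mem_Icc {p : Fin m → ℝ} (hp : ∀ k, p k ∈ Set.Icc (0 : ℝ) 1) :
    (∑ k, p k) / m ∈ Set.Icc (0 : ℝ) 1 := by
  refine ⟨div_nonneg (Finset.sum_nonneg fun k _ => (hp k).1) (Nat.cast_nonneg m), ?_⟩
  refine div_le_one_of_le₀ ?_ (Nat.cast_nonneg m)
  simpa using Finset.sum_le_sum fun k (_ : k ∈ Finset.univ) => (hp k).2

lemma integral_mem_Icc {μ : Measure Ω} [IsProbabilityMeasure μ] {p : Ω → ℝ}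
    (hp : ∀ z, p z ∈ Set.Icc (0 : ℝ) 1) : ∫ z, p z ∂μ ∈ Set.Icc (0 : ℝ) 1 := by
  refine ⟨integral_nonneg fun z => (hp z).1, ?_⟩
  have := norm_integral_le_of_norm_le_const (μ := μ) (f := p) (C := 1)
    (Filter.Eventually.of_forall fun z => by
      rw [Real.norm_eq_abs, abs_of_nonneg (hp z).1]; exact (hp z).2)
  simpa using (le_abs_self _).trans this

variable {μ : Measure Ω} {ψ : ι → Ω → ℝ}

lemma measurable_uniformDeviation [Countable ι] (hψ : ∀ i, Measurable (ψ i)) :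
    Measurable fun S : Fin m → Ω => uniformDeviation μ ψ S := by
  refine Measurable.iSup fun i => ?_
  have := hψ i
  fun_prop

variable [IsProbabilityMeasure μ]

lemma abs_deviation_le (h01 : ∀ i z, ψ i z ∈ Set.Icc (0 : ℝ) 1) (S : Fin m → Ω) (i : ι) :
    |∫ z, ψ i z ∂μ - (∑ k, ψ i (S k)) / m| ≤ 1 := by
  have h1 := integral_mem_Icc (μ := μ) (h01 i)
  have h2 := sum_div_mem_Icc fun k => h01 i (S k)
  rw [abs_le]
  constructor <;> linarith [h1.1, h1.2, h2.1, h2.2]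

lemma bddAbove_deviation (h01 : ∀ i z, ψ i z ∈ Set.Icc (0 : ℝ) 1) (S : Fin m → Ω) :
    BddAbove (Set.range fun i => ∫ z, ψ i z ∂μ - (∑ k, ψ i (S k)) / m) := by
  refine ⟨1, ?_⟩
  rintro _ ⟨i, rfl⟩
  exact (le_abs_self _).trans (abs_deviation_le h01 S i)

lemma abs_uniformDeviation_le [Nonempty ι] (h01 : ∀ i z, ψ i z ∈ Set.Icc (0 : ℝ) 1)
    (S : Fin m → Ω) : |uniformDeviation μ ψ S| ≤ 1 := by
  rw [abs_le]
  constructor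
  · obtain ⟨i⟩ := ‹Nonempty ι›
    exact (abs_le.1 (abs_deviation_le h01 S i)).1.trans (le_ciSup (bddAbove_deviation h01 S) i)
  · exact ciSup_le fun i => (le_abs_self _).trans (abs_deviation_le h01 S i)

lemma uniformDeviation_le_add [Nonempty ι] (h01 : ∀ i z, ψ i z ∈ Set.Icc (0 : ℝ) 1)
    (S : Fin m → Ω) (j : Fin m) (z : Ω) :
    uniformDeviation μ ψ S ≤ uniformDeviation μ ψ (Function.update S j z) + 1 / m := by
  refine ciSup_le fun i => ?_
  have h := le_ciSup (bddAbove_deviation (μ := μ) h01 (Function.update S j z)) i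
  have e1 : ∑ k, ψ i (S k) = ∑ k ∈ Finset.univ.erase j, ψ i (S k) + ψ i (S j) :=
    (Finset.sum_erase_add _ _ (Finset.mem_univ j)).symm
  have e2 : ∑ k, ψ i (Function.update S j z k) =
      ∑ k ∈ Finset.univ.erase j, ψ i (S k) + ψ i z := by
    rw [← Finset.sum_erase_add _ _ (Finset.mem_univ j)]
    congr 1
    · refine Finset.sum_congr rfl fun k hk => ?_
      rw [Function.update_of_ne (Finset.mem_erase.1 hk).1]
    · rw [Function.update_self]
  have h3 : (∑ k, ψ i (Function.update S j z k)) / m ≤ (∑ k, ψ i (S k)) / m + 1 / m := by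
    rw [← add_div, e1, e2]
    refine div_le_div_of_nonneg_right ?_ (Nat.cast_nonneg m)
    linarith [(h01 i (S j)).1, (h01 i z).2]
  rw [uniformDeviation]
  linarith

lemma abs_uniformDeviation_sub_le [Nonempty ι] (h01 : ∀ i z, ψ i z ∈ Set.Icc (0 : ℝ) 1)
    (S : Fin m → Ω) (j : Fin m) (z : Ω) :
    |uniformDeviation μ ψ S - uniformDeviation μ ψ (Function.update S j z)| ≤ 1 / m := by
  have h1 := uniformDeviation_le_add (μ := μ) h01 S j z
  have h2 := uniformDeviation_le_add (μ := μ) h01 (Function.update S j z) j (S j)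
  rw [Function.update_idem, Function.update_eq_self] at h2
  rw [abs_le]
  constructor <;> linarith

lemma abs_le_one_of_mem_Icc {x : ℝ} (h : x ∈ Set.Icc (0 : ℝ) 1) : |x| ≤ 1 := by
  rw [abs_of_nonneg h.1]; exact h.2

lemma abs_iSup_sum_sign_mul_le [Nonempty ι] {v : ι → Fin m → ℝ} {C : ℝ}
    (hC : ∀ i k, |v i k| ≤ C) (ε : Fin m → ℤˣ) :
    |⨆ i, ∑ k, ((ε k : ℤ) : ℝ) * v i k| ≤ m * C := by
  rw [abs_le]
  constructor
  · obtain ⟨i⟩ := ‹Nonempty ι›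
    exact (abs_le.1 (abs_sum_sign_mul_le (hC i) ε)).1.trans
      (le_ciSup (bddAbove_sum_sign_mul hC ε) i)
  · exact ciSup_le fun i => (le_abs_self _).trans (abs_sum_sign_mul_le (hC i) ε)

lemma measurePreserving_swap_coordinates (ε : Fin m → ℤˣ) :
    MeasurePreserving (fun (q : Fin m → Ω × Ω) k => if ε k = 1 then q k else (q k).swap)
      (Measure.pi fun _ => μ.prod μ) (Measure.pi fun _ => μ.prod μ) := by
  refine measurePreserving_pi (fun _ => μ.prod μ) (fun _ => μ.prod μ)
    (f := fun k (z : Ω × Ω) => if ε k = 1 then z else z.swap) fun k => ?_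
  by_cases h : ε k = 1
  · simp only [h, if_true]
    exact MeasurePreserving.id (μ.prod μ)
  · simpa [h] using Measure.measurePreserving_swap (μ := μ) (ν := μ)

/-- A sign `-1` at `k` amounts to exchanging the `k`-th point with its ghost, which preserves the
joint law. -/
lemma integral_ghost_sign_eq [Countable ι] (hψ : ∀ i, Measurable (ψ i)) (ε : Fin m → ℤˣ) :
    ∫ p : (Fin m → Ω) × (Fin m → Ω), (⨆ i, ∑ k, ((ε k : ℤ) : ℝ) * (ψ i (p.2 k) - ψ i (p.1 k)))
        ∂((Measure.pi fun _ => μ).prod (Measure.pi fun _ => μ)) =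
      ∫ p : (Fin m → Ω) × (Fin m → Ω), (⨆ i, ∑ k, (ψ i (p.2 k) - ψ i (p.1 k)))
        ∂((Measure.pi fun _ => μ).prod (Measure.pi fun _ => μ)) := by
  have hmp := measurePreserving_arrowProdEquivProdArrow Ω Ω (Fin m) (fun _ => μ) (fun _ => μ)
  rw [← hmp.integral_comp', ← hmp.integral_comp']
  have hsw := measurePreserving_swap_coordinates (μ := μ) ε
  have hmeas : Measurable fun q : Fin m → Ω × Ω =>
      ⨆ i, ∑ k, (ψ i (q k).2 - ψ i (q k).1) := by
    refine Measurable.iSup fun i => ?_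
    have := hψ i
    fun_prop
  have h := integral_map (μ := Measure.pi fun _ : Fin m => μ.prod μ) hsw.measurable.aemeasurable
    (f := fun q : Fin m → Ω × Ω => ⨆ i, ∑ k, (ψ i (q k).2 - ψ i (q k).1))
    hmeas.aestronglyMeasurable
  rw [hsw.map_eq] at h
  refine Eq.trans ?_ h.symm
  refine integral_congr_ae (Filter.Eventually.of_forall fun q => ?_)
  refine iSup_congr fun i => Finset.sum_congr rfl fun k _ => ?_
  change ((ε k : ℤ) : ℝ) * (ψ i (q k).2 - ψ i (q k).1) = _
  rcases Int.units_eq_one_or (ε k) with hk | hk <;> simp [hk]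

/-- Each expectation is the mean over an independent ghost sample, and a supremum of means is at
most the mean of the supremum. Random signs may then be inserted for free, and the two samples
separated; each contributes one Rademacher average. -/
theorem integral_uniformDeviation_le [Countable ι] [Nonempty ι] (hm : 0 < m)
    (hψ : ∀ i, Measurable (ψ i)) (h01 : ∀ i z, ψ i z ∈ Set.Icc (0 : ℝ) 1) :
    2 ^ m * m * ∫ S : Fin m → Ω, uniformDeviation μ ψ S ∂(Measure.pi fun _ => μ) ≤
      2 * ∫ S : Fin m → Ω, signSum (fun i k => ψ i (S k)) ∂(Measure.pi fun _ => μ) := by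
  have hm' : (0 : ℝ) < m := by exact_mod_cast hm
  set P : Measure (Fin m → Ω) := Measure.pi fun _ => μ with hP
  set G : (Fin m → Ω) × (Fin m → Ω) → ℝ := fun p => ⨆ i, ∑ k, (ψ i (p.2 k) - ψ i (p.1 k)) with hG
  have hdiff : ∀ (p : (Fin m → Ω) × (Fin m → Ω)) i k, |ψ i (p.2 k) - ψ i (p.1 k)| ≤ 1 := by
    intro p i k
    have h1 := h01 i (p.2 k)
    have h2 := h01 i (p.1 k)
    rw [abs_le]
    constructor <;> linarith [h1.1, h1.2, h2.1, h2.2]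
  have hGm : Measurable G := by
    refine Measurable.iSup fun i => ?_
    have := hψ i
    fun_prop
  have hone : ∀ (p : (Fin m → Ω) × (Fin m → Ω)) i, ∑ k, (ψ i (p.2 k) - ψ i (p.1 k)) =
      ∑ k, ((((1 : Fin m → ℤˣ) k : ℤˣ) : ℤ) : ℝ) * (ψ i (p.2 k) - ψ i (p.1 k)) := by
    intro p i; simp
  have hGb : ∀ p, |G p| ≤ m * 1 := by
    intro p
    simp only [hG, hone]
    exact abs_iSup_sum_sign_mul_le (hdiff p) 1
  have hGbdd : ∀ p : (Fin m → Ω) × (Fin m → Ω),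
      BddAbove (Set.range fun i => ∑ k, (ψ i (p.2 k) - ψ i (p.1 k))) := by
    intro p
    simp only [hone]
    exact bddAbove_sum_sign_mul (hdiff p) 1
  have hGint : Integrable G (P.prod P) := integrable_of_abs_le hGm hGb
  have hΦint : Integrable (fun S : Fin m → Ω => uniformDeviation μ ψ S) P :=
    integrable_of_abs_le (measurable_uniformDeviation hψ) (abs_uniformDeviation_le h01)
  have hGhost : ∀ S, m * uniformDeviation μ ψ S ≤ ∫ S', G (S, S') ∂P := by
    intro S
    rw [uniformDeviation, Real.mul_iSup_of_nonneg hm'.le]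
    refine ciSup_le fun i => ?_
    have e : m * (∫ z, ψ i z ∂μ - (∑ k, ψ i (S k)) / m) =
        ∫ S' : Fin m → Ω, ∑ k, (ψ i (S' k) - ψ i (S k)) ∂P := by
      have hk : ∀ k : Fin m, Integrable (fun S' : Fin m → Ω => ψ i (S' k)) P := fun k =>
        integrable_of_abs_le ((hψ i).comp (measurable_pi_apply k)) fun S' =>
          abs_le_one_of_mem_Icc (h01 i _)
      have hks : ∀ k ∈ Finset.univ,
          Integrable (fun S' : Fin m → Ω => ψ i (S' k) - ψ i (S k)) P := fun k _ =>
        (hk k).sub (integrable_const _)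
      rw [integral_finsetSum _ hks]
      have hk2 : ∀ k : Fin m, ∫ S' : Fin m → Ω, (ψ i (S' k) - ψ i (S k)) ∂P =
          ∫ z, ψ i z ∂μ - ψ i (S k) := by
        intro k
        rw [integral_sub (hk k) (integrable_const _)]
        congr 1
        · have hev := measurePreserving_eval (fun _ : Fin m => μ) k
          have := integral_map (μ := P) hev.measurable.aemeasurable (f := ψ i)
            (hψ i).aestronglyMeasurable
          rw [hev.map_eq] at this
          exact this.symm
        · simp
      simp_rw [hk2, Finset.sum_sub_distrib]
      simp
      field_simp
    rw [e]
    refine integral_mono ?_ ?_ fun S' => le_ciSup (hGbdd (S, S')) i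
    · refine integrable_of_abs_le (C := m * 1) ?_ fun S' => ?_
      · have := hψ i
        fun_prop
      · rw [hone (S, S')]
        exact abs_sum_sign_mul_le (hdiff (S, S') i) 1
    · exact integrable_of_abs_le (hGm.comp measurable_prodMk_left) fun S' => hGb _
  have h1 : m * ∫ S, uniformDeviation μ ψ S ∂P ≤ ∫ p, G p ∂(P.prod P) := by
    rw [integral_prod _ hGint, ← integral_const_mul]
    exact integral_mono (hΦint.const_mul _) hGint.integral_prod_left hGhost
  set R : (Fin m → ℤˣ) → (Fin m → Ω) → ℝ := fun ε S => ⨆ i, ∑ k, ((ε k : ℤ) : ℝ) * ψ i (S k)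
    with hR
  have hRm : ∀ ε, Measurable (R ε) := by
    intro ε
    refine Measurable.iSup fun i => ?_
    have := hψ i
    fun_prop
  have hψabs : ∀ (S : Fin m → Ω) i k, |ψ i (S k)| ≤ 1 := fun S i k =>
    abs_le_one_of_mem_Icc (h01 i _)
  have hRb : ∀ ε S, |R ε S| ≤ m * 1 := fun ε S => abs_iSup_sum_sign_mul_le (hψabs S) ε
  have hRint : ∀ ε, Integrable (R ε) P := fun ε => integrable_of_abs_le (hRm ε) (hRb ε)
  have h2 : ∀ ε : Fin m → ℤˣ, ∫ p, G p ∂(P.prod P) ≤ ∫ S, R ε S ∂P + ∫ S, R (-ε) S ∂P := by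
    intro ε
    have e := integral_ghost_sign_eq (μ := μ) hψ ε
    rw [← hP] at e
    rw [hG, ← e]
    have e2 : ∫ p : (Fin m → Ω) × (Fin m → Ω), (R ε p.2 + R (-ε) p.1) ∂(P.prod P) =
        ∫ S, R ε S ∂P + ∫ S, R (-ε) S ∂P := by
      rw [integral_add, integral_fun_snd, integral_fun_fst]
      · simp
      · exact (hRint ε).comp_snd P
      · exact (hRint (-ε)).comp_fst P
    rw [← e2]
    refine integral_mono ?_ (((hRint ε).comp_snd P).add ((hRint (-ε)).comp_fst P)) fun p => ?_
    · refine integrable_of_abs_le (C := m * 1) ?_ fun p => abs_iSup_sum_sign_mul_le (hdiff p) ε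
      refine Measurable.iSup fun i => ?_
      have := hψ i
      fun_prop
    · refine ciSup_le fun i => ?_
      have b1 := le_ciSup (bddAbove_sum_sign_mul (hψabs p.2) ε) i
      have b2 := le_ciSup (bddAbove_sum_sign_mul (hψabs p.1) (-ε)) i
      refine le_trans (le_of_eq ?_) (add_le_add b1 b2)
      rw [← Finset.sum_add_distrib]
      refine Finset.sum_congr rfl fun k _ => ?_
      simp
      ring
  have h3 : ∑ _ε : Fin m → ℤˣ, ∫ p, G p ∂(P.prod P) ≤
      ∑ ε : Fin m → ℤˣ, ∫ S, R ε S ∂P + ∑ ε : Fin m → ℤˣ, ∫ S, R (-ε) S ∂P := by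
    rw [← Finset.sum_add_distrib]
    exact Finset.sum_le_sum fun ε _ => h2 ε
  have h4 : ∑ ε : Fin m → ℤˣ, ∫ S, R (-ε) S ∂P = ∑ ε : Fin m → ℤˣ, ∫ S, R ε S ∂P :=
    Equiv.sum_comp (Equiv.neg (Fin m → ℤˣ)) fun ε => ∫ S, R ε S ∂P
  have h5 : ∫ S : Fin m → Ω, signSum (fun i k => ψ i (S k)) ∂P =
      ∑ ε : Fin m → ℤˣ, ∫ S, R ε S ∂P := integral_finsetSum _ fun ε _ => hRint ε
  have h6 : ∑ _ε : Fin m → ℤˣ, ∫ p, G p ∂(P.prod P) = 2 ^ m * ∫ p, G p ∂(P.prod P) := by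
    simp
  rw [h4, h6, ← h5] at h3
  have h7 := mul_le_mul_of_nonneg_left h1 (by positivity : (0 : ℝ) ≤ 2 ^ m)
  linarith

end Symmetrization

/-! ### Ramp loss and the margin bound for a fixed cap on the output weights. -/

section Margin

/-- The ramp loss, `1` on the negative half-line and `0` from `1` on. -/
noncomputable def ramp (u : ℝ) : ℝ := max 0 (min 1 (1 - u))

lemma ramp_mem_Icc (u : ℝ) : ramp u ∈ Set.Icc (0 : ℝ) 1 :=
  ⟨le_max_left _ _, max_le zero_le_one (min_le_left _ _)⟩

lemma ramp_of_nonpos {u : ℝ} (hu : u ≤ 0) : ramp u = 1 := by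
  rw [ramp, min_eq_left (by linarith), max_eq_right zero_le_one]

lemma ramp_of_one_le {u : ℝ} (hu : 1 ≤ u) : ramp u = 0 :=
  max_eq_left ((min_le_right _ _).trans (by linarith))

@[fun_prop]
lemma continuous_ramp : Continuous ramp := by
  unfold ramp
  fun_prop

lemma abs_ramp_sub_le (u v : ℝ) : |ramp u - ramp v| ≤ |u - v| := by
  have h1 := abs_max_sub_max_le_abs (min 1 (1 - u)) (min 1 (1 - v)) 0
  have h2 := abs_min_sub_min_le_max 1 (1 - u) 1 (1 - v)
  rw [max_comm (min 1 (1 - u)), max_comm (min 1 (1 - v))] at h1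
  refine h1.trans (h2.trans ?_)
  simp only [sub_self, abs_zero, sub_sub_sub_cancel_left]
  exact max_le (abs_nonneg _) (abs_sub_comm v u).le

lemma signSum_const_mul {ι : Type*} {m : ℕ} {c : ℝ} (hc : 0 ≤ c) (v : ι → Fin m → ℝ) :
    signSum (fun i k => c * v i k) = c * signSum v := by
  rw [signSum, signSum, Finset.mul_sum]
  refine Finset.sum_congr rfl fun ε _ => ?_
  rw [Real.mul_iSup_of_nonneg hc]
  refine iSup_congr fun i => ?_
  rw [Finset.mul_sum]
  exact Finset.sum_congr rfl fun k _ => by ring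

/-- Contraction by `u ↦ θ * ramp (y * u / θ)`, which is 1-Lipschitz because `|y| ≤ 1`. -/
lemma signSum_ramp_le {X : Type*} {m : ℕ} {F : Set (X → ℝ)} (hne : F.Nonempty)
    {S : Fin m → X × ℝ} (hS : ∀ k, |(S k).2| ≤ 1) {C : ℝ}
    (hC : ∀ i k, |sampleVectors F (fun k => (S k).1) i k| ≤ C) {θ : ℝ} (hθ : 0 < θ) :
    signSum (fun (f : F) k => ramp ((S k).2 * f.1 (S k).1 / θ)) ≤
      signSum (sampleVectors F fun k => (S k).1) / θ := by
  have : Nonempty F := hne.to_subtype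
  rw [le_div_iff₀ hθ, mul_comm, ← signSum_const_mul hθ.le]
  refine signSum_contraction hC (φ := fun k u => θ * ramp ((S k).2 * u / θ)) fun k u v => ?_
  rw [← mul_sub, abs_mul, abs_of_pos hθ]
  calc θ * |ramp ((S k).2 * u / θ) - ramp ((S k).2 * v / θ)|
      ≤ θ * |(S k).2 * u / θ - (S k).2 * v / θ| :=
        mul_le_mul_of_nonneg_left (abs_ramp_sub_le _ _) hθ.le
    _ = |(S k).2| * |u - v| := by
        rw [← sub_div, ← mul_sub, abs_div, abs_mul, abs_of_pos hθ]
        field_simp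
    _ ≤ |u - v| := mul_le_of_le_one_left (abs_nonneg _) (hS k)

lemma signSum_sampleVectors_mono {X : Type*} {m : ℕ} {F G : Set (X → ℝ)} (hFG : F ⊆ G)
    (hne : F.Nonempty) {x : Fin m → X} {C : ℝ} (hC : ∀ i k, |sampleVectors G x i k| ≤ C) :
    signSum (sampleVectors F x) ≤ signSum (sampleVectors G x) := by
  have : Nonempty F := hne.to_subtype
  refine Finset.sum_le_sum fun ε _ => ciSup_le fun i => ?_
  exact le_ciSup (bddAbove_sum_sign_mul hC ε) ⟨i.1, hFG i.2⟩

/-- The space `C(X, ℝ)` is second countable, so each of its subspaces is separable, and convergence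
there implies pointwise convergence. This allows the supremum over an uncountable class to be
replaced by a countable, hence measurable, one. -/
lemma exists_countable_pointwise_dense {X : Type*} [TopologicalSpace X]
    [SecondCountableTopology X] [LocallyCompactSpace X] {F : Set (X → ℝ)}
    (hF : ∀ f ∈ F, Continuous f) :
    ∃ G ⊆ F, G.Countable ∧ ∀ f ∈ F, ∃ u : ℕ → X → ℝ, (∀ j, u j ∈ G) ∧
      ∀ x, Filter.Tendsto (fun j => u j x) Filter.atTop (nhds (f x)) := by
  obtain ⟨s, hs, hd⟩ := TopologicalSpace.exists_countable_dense {f : C(X, ℝ) | ⇑f ∈ F}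
  refine ⟨(fun f : {f : C(X, ℝ) | ⇑f ∈ F} => ⇑f.1) '' s, ?_, hs.image _, fun f hf => ?_⟩
  · rintro _ ⟨f, -, rfl⟩
    exact f.2
  · have hmem : (⟨⟨f, hF f hf⟩, hf⟩ : {f : C(X, ℝ) | ⇑f ∈ F}) ∈ closure s := hd _
    obtain ⟨u, hu, hlim⟩ := mem_closure_iff_seq_limit.1 hmem
    refine ⟨fun j => ⇑(u j).1, fun j => ⟨u j, hu j, rfl⟩, fun x => ?_⟩
    have hc : Continuous fun g : {f : C(X, ℝ) | ⇑f ∈ F} => g.1 x :=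
      (continuous_eval_const x).comp continuous_subtype_val
    exact (hc.tendsto _).comp hlim

variable {n m : ℕ}

lemma trueError_le_integral_ramp (D : Measure ((Fin n → ℝ) × ℝ)) [IsProbabilityMeasure D]
    {F : (Fin n → ℝ) → ℝ} (hF : Continuous F) {θ : ℝ} (hθ : 0 < θ) :
    trueError D F ≤ ∫ z, ramp (z.2 * F z.1 / θ) ∂D := by
  have hmeas : MeasurableSet {z : (Fin n → ℝ) × ℝ | z.2 * F z.1 ≤ 0} :=
    measurableSet_le (by fun_prop) measurable_const
  rw [trueError, ← integral_indicator_one hmeas]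
  have hm : Measurable fun z : (Fin n → ℝ) × ℝ => ramp (z.2 * F z.1 / θ) := by fun_prop
  refine integral_mono ((integrable_const (1 : ℝ)).indicator hmeas)
    (integrable_of_abs_le hm fun z => abs_le_one_of_mem_Icc (ramp_mem_Icc _)) fun z => ?_
  by_cases hz : z ∈ {z : (Fin n → ℝ) × ℝ | z.2 * F z.1 ≤ 0}
  · simp only [Set.indicator_of_mem hz, Pi.one_apply]
    rw [ramp_of_nonpos (div_nonpos_of_nonpos_of_nonneg hz hθ.le)]
  · rw [Set.indicator_of_notMem hz]
    exact (ramp_mem_Icc _).1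

lemma sum_ramp_div_le_marginError (S : Fin m → (Fin n → ℝ) × ℝ) (F : (Fin n → ℝ) → ℝ)
    {θ : ℝ} (hθ : 0 < θ) :
    (∑ k, ramp ((S k).2 * F (S k).1 / θ)) / m ≤ marginError S θ F := by
  refine div_le_div_of_nonneg_right ?_ (Nat.cast_nonneg m)
  rw [Finset.card_filter]
  push_cast
  refine Finset.sum_le_sum fun k _ => ?_
  split_ifs with h
  · exact (ramp_mem_Icc _).2
  · rw [ramp_of_one_le ((one_le_div hθ).2 (not_le.1 h).le)]

/-- The margin bound for a family of continuous functions whose Rademacher complexity on a sample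
`S` is at most `ρ S`. -/
theorem exists_measurableSet_margin_bound (hm : 0 < m) (D : Measure ((Fin n → ℝ) × ℝ))
    [IsProbabilityMeasure D] (hlabel : ∀ᵐ z ∂D, |z.2| ≤ 1) {F : Set ((Fin n → ℝ) → ℝ)}
    (hne : F.Nonempty) (hcont : ∀ f ∈ F, Continuous f) {K : ℝ} (hK : 0 ≤ K)
    (hbound : ∀ f ∈ F, ∀ x, |f x| ≤ K * ‖x‖)
    {ρ : (Fin m → (Fin n → ℝ) × ℝ) → ℝ} (hρ : Integrable ρ (sampleLaw D m))
    (hρF : ∀ S : Fin m → (Fin n → ℝ) × ℝ,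
      signSum (sampleVectors F fun k => (S k).1) ≤ 2 ^ m * m * ρ S)
    {θ s : ℝ} (hθ : 0 < θ) (hs : 0 ≤ s) :
    ∃ E : Set (Fin m → (Fin n → ℝ) × ℝ), MeasurableSet E ∧
      (sampleLaw D m).real Eᶜ ≤ Real.exp (-2 * m * s ^ 2) ∧
      ∀ S ∈ E, ∀ f ∈ F,
        trueError D f ≤ marginError S θ f + 2 / θ * ∫ S, ρ S ∂(sampleLaw D m) + s := by
  have hm' : (0 : ℝ) < m := by exact_mod_cast hm
  obtain ⟨G, hGF, hGc, hGd⟩ := exists_countable_pointwise_dense hcont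
  have hGne : G.Nonempty := by
    obtain ⟨f, hf⟩ := hne
    obtain ⟨u, hu, -⟩ := hGd f hf
    exact ⟨u 0, hu 0⟩
  have : Nonempty G := hGne.to_subtype
  have : Countable G := hGc.to_subtype
  set ψ : G → (Fin n → ℝ) × ℝ → ℝ := fun f z => ramp (z.2 * f.1 z.1 / θ) with hψdef
  have hψ : ∀ i, Measurable (ψ i) := fun i => by
    have := hcont i.1 (hGF i.2)
    fun_prop
  have h01 : ∀ i z, ψ i z ∈ Set.Icc (0 : ℝ) 1 := fun i z => ramp_mem_Icc _
  have hsign : ∀ᵐ S ∂(sampleLaw D m), ∀ k, |(S k).2| ≤ 1 :=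
    ae_all_iff.2 fun k =>
      (measurePreserving_eval (fun _ : Fin m => D) k).quasiMeasurePreserving.ae hlabel
  have hC : ∀ (S : Fin m → (Fin n → ℝ) × ℝ) (i : F) k,
      |sampleVectors F (fun k => (S k).1) i k| ≤ K * ∑ k, ‖(S k).1‖ := by
    intro S i k
    refine (hbound i.1 i.2 _).trans (mul_le_mul_of_nonneg_left ?_ hK)
    exact Finset.single_le_sum (f := fun k => ‖(S k).1‖) (fun _ _ => norm_nonneg _)
      (Finset.mem_univ k)
  have hrad : ∀ᵐ S ∂(sampleLaw D m),
      signSum (fun i k => ψ i (S k)) ≤ 2 ^ m * m * (ρ S / θ) := by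
    filter_upwards [hsign] with S hS
    refine (signSum_ramp_le hGne hS (fun i k => hC S ⟨i.1, hGF i.2⟩ k) hθ).trans ?_
    rw [mul_div_assoc']
    refine div_le_div_of_nonneg_right ?_ hθ.le
    exact (signSum_sampleVectors_mono hGF hGne (hC S)).trans (hρF S)
  have hprob : IsProbabilityMeasure (sampleLaw D m) := by unfold sampleLaw; infer_instance
  have hsignInt : Integrable (fun S : Fin m → (Fin n → ℝ) × ℝ => signSum fun i k => ψ i (S k))
      (sampleLaw D m) := by
    refine integrable_finsetSum _ fun ε _ => ?_
    refine Integrable.of_bound (C := m * 1) ?_ (Filter.Eventually.of_forall fun S =>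
      abs_iSup_sum_sign_mul_le (fun i k => abs_le_one_of_mem_Icc (h01 i (S k))) ε)
    refine (Measurable.iSup fun i => ?_).aestronglyMeasurable
    have := hψ i
    fun_prop
  have hE : ∫ S, uniformDeviation D ψ S ∂(sampleLaw D m) ≤
      2 / θ * ∫ S, ρ S ∂(sampleLaw D m) := by
    have h1 := integral_uniformDeviation_le (μ := D) hm hψ h01
    have h2 := integral_mono_ae hsignInt ((hρ.div_const θ).const_mul (2 ^ m * m : ℝ)) hrad
    rw [integral_const_mul, integral_div] at h2
    have h3 : (0 : ℝ) < 2 ^ m * m := by positivity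
    refine le_of_mul_le_mul_left (h1.trans ((mul_le_mul_of_nonneg_left h2 zero_le_two).trans
      (le_of_eq ?_))) h3
    ring
  refine ⟨{S | uniformDeviation D ψ S <
    ∫ S', uniformDeviation D ψ S' ∂(sampleLaw D m) + s}, ?_, ?_, ?_⟩
  · exact measurableSet_lt (measurable_uniformDeviation hψ) measurable_const
  · have := measure_ge_le_of_bounded_differences D hm (measurable_uniformDeviation (μ := D) hψ)
      (abs_uniformDeviation_le h01) (abs_uniformDeviation_sub_le h01) hs
    refine le_trans (le_of_eq ?_) this
    congr 1
    ext S
    simp [sampleLaw]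
  · intro S hS f hf
    obtain ⟨u, hu, hlim⟩ := hGd f hf
    have hfin : ∀ j, ∫ z, ramp (z.2 * u j z.1 / θ) ∂D ≤
        (∑ k, ramp ((S k).2 * u j (S k).1 / θ)) / m +
          (2 / θ * ∫ S, ρ S ∂(sampleLaw D m) + s) := by
      intro j
      have h1 := le_ciSup (bddAbove_deviation (μ := D) h01 S) ⟨u j, hu j⟩
      have h2 : uniformDeviation D ψ S < _ := hS
      have h3 : ∫ z, ramp (z.2 * u j z.1 / θ) ∂D -
        (∑ k, ramp ((S k).2 * u j (S k).1 / θ)) / m ≤ uniformDeviation D ψ S := h1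
      linarith
    have hz : ∀ z : (Fin n → ℝ) × ℝ, Filter.Tendsto (fun j => ramp (z.2 * u j z.1 / θ))
        Filter.atTop (nhds (ramp (z.2 * f z.1 / θ))) := fun z =>
      (continuous_ramp.tendsto _).comp (((hlim z.1).const_mul z.2).div_const θ)
    -- The inequality for the ramp loss passes from the countable subclass to `f` by dominated
    -- convergence. The discontinuous error indicators enter only after the limit.
    have hl1 : Filter.Tendsto (fun j => ∫ z, ramp (z.2 * u j z.1 / θ) ∂D) Filter.atTop
        (nhds (∫ z, ramp (z.2 * f z.1 / θ) ∂D)) := by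
      refine tendsto_integral_of_dominated_convergence (fun _ => 1) (fun j => ?_)
        (integrable_const _) (fun j => Filter.Eventually.of_forall fun z => ?_)
        (Filter.Eventually.of_forall hz)
      · exact (hψ ⟨u j, hu j⟩).aestronglyMeasurable
      · exact abs_le_one_of_mem_Icc (ramp_mem_Icc _)
    have hl2 : Filter.Tendsto (fun j => (∑ k, ramp ((S k).2 * u j (S k).1 / θ)) / m +
        (2 / θ * ∫ S, ρ S ∂(sampleLaw D m) + s)) Filter.atTop
        (nhds ((∑ k, ramp ((S k).2 * f (S k).1 / θ)) / m +
          (2 / θ * ∫ S, ρ S ∂(sampleLaw D m) + s))) :=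
      ((tendsto_finsetSum _ fun k _ => hz (S k)).div_const _).add_const _
    have h4 := le_of_tendsto_of_tendsto' hl1 hl2 hfin
    have h5 := trueError_le_integral_ramp D (hcont f hf) hθ
    have h6 := sum_ramp_div_le_marginError S f hθ
    linarith

/-- The margin bound for networks with output weights of `ℓ₁` norm at most `a`. -/
theorem exists_measurableSet_netFamily_bound (hn : 0 < n) (hm : 0 < m) (T : ℕ)
    {σ : ℕ → ℝ → ℝ} (hσ : ∀ t, LipschitzWith 1 (σ t)) (hσ0 : ∀ t, σ t 0 = 0)
    {lam : ℕ → ℝ} (hlam : ∀ t, 0 ≤ lam t)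
    (D : Measure ((Fin n → ℝ) × ℝ)) [IsProbabilityMeasure D]
    (hlabel : ∀ᵐ z ∂D, |z.2| ≤ 1)
    (hr : Integrable (fun S : Fin m → (Fin n → ℝ) × ℝ => maxInputNorm S) (sampleLaw D m))
    {θ s a : ℝ} (hθ : 0 < θ) (hs : 0 ≤ s) (ha : 0 ≤ a) :
    ∃ E : Set (Fin m → (Fin n → ℝ) × ℝ), MeasurableSet E ∧
      (sampleLaw D m).real Eᶜ ≤ Real.exp (-2 * m * s ^ 2) ∧
      ∀ S ∈ E, ∀ f ∈ netFamily n T σ lam a,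
        trueError D f ≤ marginError S θ f +
          2 * (a * rInf D m * (∑ t ∈ Finset.range (T + 1), weightProd lam t) / θ) *
            Real.sqrt (Real.log (2 * n) / (2 * m)) + s := by
  set B := ∑ t ∈ Finset.range (T + 1), weightProd lam t
  set c := Real.sqrt (Real.log (2 * n) / (2 * m))
  obtain ⟨E, hE, hEm, h⟩ := exists_measurableSet_margin_bound (s := s) hm D hlabel
    (F := netFamily n T σ lam a) ⟨_, zero_mem_netFamily hlam ha⟩ (continuous_of_mem_netFamily hσ)
    (K := a * ∑ t ∈ Finset.range (T + 1), ∏ s ∈ Finset.range (t + 1), lam s)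
    (mul_nonneg ha (Finset.sum_nonneg fun t _ => Finset.prod_nonneg fun s _ => hlam s))
    (fun f hf x => (abs_le_of_mem_netFamily hσ hσ0 hlam f hf x).trans (le_of_eq (by ring)))
    (ρ := fun S => a * B * c * maxInputNorm S) (hr.const_mul _) (fun S => by
      have hx : ∀ k, ‖(S k).1‖ ≤ maxInputNorm S := fun k =>
        le_ciSup (f := fun k => ‖(S k).1‖) (Set.finite_range _).bddAbove k
      exact (signSum_netFamily_le hn hlam hσ hσ0 hm hx ha).trans (le_of_eq (by ring))) hθ hs
  refine ⟨E, hE, hEm, fun S hS f hf => (h S hS f hf).trans (le_of_eq ?_)⟩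
  rw [integral_const_mul, ← rInf]
  ring

end Margin

/-! ### Small output weights: counting inputs of exceptional norm. -/

section RareEvent

variable {Ω : Type*} [MeasurableSpace Ω] {m : ℕ}

/-- The number of points of the sample `S` in the set `A`. -/
noncomputable def hits {α : Type*} (A : Set α) (S : Fin m → α) : ℝ :=
  ∑ k, A.indicator (1 : α → ℝ) (S k)

lemma indicator_one_mem_Icc {α : Type*} (A : Set α) (z : α) :
    A.indicator (1 : α → ℝ) z ∈ Set.Icc (0 : ℝ) 1 := by
  by_cases hz : z ∈ A <;> simp [hz]

lemma measurable_hits {A : Set Ω} (hA : MeasurableSet A) :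
    Measurable fun S : Fin m → Ω => hits A S := by
  have : Measurable fun z => A.indicator (1 : Ω → ℝ) z := measurable_one.indicator hA
  unfold hits
  fun_prop

lemma abs_hits_le {α : Type*} (A : Set α) (S : Fin m → α) : |hits A S| ≤ m := by
  refine (Finset.abs_sum_le_sum_abs _ _).trans ?_
  simpa using Finset.sum_le_sum fun k (_ : k ∈ Finset.univ) =>
    abs_le_one_of_mem_Icc (indicator_one_mem_Icc A (S k))

/-- With `p` the measure of `A`, the sample avoids `A` with probability `(1 - p) ^ m ≤ exp (-m p)`.
This is at least `21 / 22`, so `1 + m p ≤ exp (m p) ≤ 22 / 21`. -/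
lemma mul_measure_le_of_rare (μ : Measure Ω) [IsProbabilityMeasure μ] {A : Set Ω}
    (hA : MeasurableSet A)
    (hrare : (Measure.pi fun _ : Fin m => μ).real {S | ∃ k, S k ∈ A} ≤ 1 / 22) :
    m * μ.real A ≤ 1 / 21 := by
  set P : Measure (Fin m → Ω) := Measure.pi fun _ => μ with hP
  set p := μ.real A with hp
  have hnone : (1 - p) ^ m = 1 - P.real {S | ∃ k, S k ∈ A} := by
    have hU : MeasurableSet {S : Fin m → Ω | ∃ k, S k ∈ A} := by
      have e : {S : Fin m → Ω | ∃ k, S k ∈ A} = ⋃ k, (fun S => S k) ⁻¹' A := by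
        ext S; simp
      rw [e]
      exact MeasurableSet.iUnion fun k => measurable_pi_apply k hA
    have e : {S : Fin m → Ω | ∃ k, S k ∈ A}ᶜ = Set.univ.pi fun _ => Aᶜ := by
      ext S; simp [Set.mem_pi]
    rw [← probReal_compl_eq_one_sub hU, e, measureReal_def, hP, Measure.pi_pi]
    simp only [Finset.prod_const, ENNReal.toReal_pow, Finset.card_univ, Fintype.card_fin]
    rw [← measureReal_def, probReal_compl_eq_one_sub hA]
  have h1 : (1 - p) ^ m ≤ Real.exp (-(m * p)) := by
    have h2 : 1 - p ≤ Real.exp (-p) := by linarith [Real.add_one_le_exp (-p)]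
    have h3 : 0 ≤ 1 - p := by linarith [measureReal_le_one (μ := μ) (s := A)]
    calc (1 - p) ^ m ≤ Real.exp (-p) ^ m := pow_le_pow_left₀ h3 h2 m
      _ = _ := by rw [← Real.exp_nat_mul]; ring_nf
  have h4 : Real.exp (m * p) ≤ 22 / 21 := by
    rw [Real.exp_neg] at h1
    have h5 : (21 : ℝ) / 22 ≤ (Real.exp (m * p))⁻¹ := by linarith
    have := inv_anti₀ (by norm_num) h5
    rw [inv_inv, inv_div] at this
    exact this
  linarith [Real.add_one_le_exp (m * p)]

lemma integral_exp_hits (μ : Measure Ω) [IsProbabilityMeasure μ] {A : Set Ω}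
    (hA : MeasurableSet A) (l : ℝ) :
    ∫ S : Fin m → Ω, Real.exp (l * hits A S) ∂(Measure.pi fun _ => μ) =
      (1 + (Real.exp l - 1) * μ.real A) ^ m := by
  have hexp : ∀ z, Real.exp (l * A.indicator (1 : Ω → ℝ) z) =
      1 + (Real.exp l - 1) * A.indicator (1 : Ω → ℝ) z := fun z => by
    by_cases hz : z ∈ A <;> simp [hz]
  have e1 : ∀ S : Fin m → Ω, Real.exp (l * hits A S) =
      ∏ k, Real.exp (l * A.indicator (1 : Ω → ℝ) (S k)) := fun S => by
    rw [hits, Finset.mul_sum, Real.exp_sum]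
  simp_rw [e1]
  rw [integral_fintype_prod_eq_pow (fun z => Real.exp (l * A.indicator (1 : Ω → ℝ) z)),
    Fintype.card_fin]
  congr 1
  simp_rw [hexp]
  have hint : Integrable (fun z => A.indicator (1 : Ω → ℝ) z) μ :=
    integrable_of_abs_le (measurable_one.indicator hA) fun z =>
      abs_le_one_of_mem_Icc (indicator_one_mem_Icc A z)
  rw [integral_add (integrable_const _) (hint.const_mul _), integral_const_mul,
    integral_indicator_one hA]
  simp

lemma exp_three_le : Real.exp 3 ≤ 22 := by
  have : Real.exp 3 = Real.exp 1 ^ 3 := by rw [← Real.exp_nat_mul]; norm_num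
  rw [this]
  calc Real.exp 1 ^ 3 ≤ 2.7182818286 ^ 3 :=
        pow_le_pow_left₀ (Real.exp_pos _).le Real.exp_one_lt_d9.le 3
    _ ≤ 22 := by norm_num

/-- If a sample of size `m` meets the set `A` with probability at most `1 / 22`, the number of
its points in `A` has a Poisson tail. -/
theorem measure_count_ge_le (μ : Measure Ω) [IsProbabilityMeasure μ] {A : Set Ω}
    (hA : MeasurableSet A)
    (hrare : (Measure.pi fun _ : Fin m => μ).real {S | ∃ k, S k ∈ A} ≤ 1 / 22) (x : ℝ) :
    (Measure.pi fun _ : Fin m => μ).real {S | x ≤ hits A S} ≤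
      Real.exp (1 - 3 * x) := by
  have hmp := mul_measure_le_of_rare μ hA hrare
  have hp0 : 0 ≤ μ.real A := measureReal_nonneg
  -- Chernoff's bound at exponent 3: since `exp 3 - 1 ≤ 21` and `m * μ.real A ≤ 1 / 21`, the
  -- exponential moment is at most `exp 1`.
  have h3 := exp_three_le
  have h3' : 0 ≤ Real.exp 3 - 1 := by linarith [Real.add_one_le_exp 3]
  have hmgf : ∫ S : Fin m → Ω, Real.exp (3 * hits A S) ∂(Measure.pi fun _ => μ) ≤
      Real.exp 1 := by
    rw [integral_exp_hits μ hA]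
    calc (1 + (Real.exp 3 - 1) * μ.real A) ^ m ≤ Real.exp ((Real.exp 3 - 1) * μ.real A) ^ m := by
          refine pow_le_pow_left₀ (by positivity) ?_ m
          linarith [Real.add_one_le_exp ((Real.exp 3 - 1) * μ.real A)]
      _ = Real.exp ((Real.exp 3 - 1) * (m * μ.real A)) := by
          rw [← Real.exp_nat_mul]; ring_nf
      _ ≤ Real.exp 1 := by
          refine Real.exp_le_exp.2 ?_
          calc (Real.exp 3 - 1) * (m * μ.real A) ≤ 21 * (1 / 21) :=
                mul_le_mul (by linarith) hmp (by positivity) (by norm_num)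
            _ = 1 := by norm_num
  have h := ProbabilityTheory.measure_ge_le_exp_mul_mgf (μ := Measure.pi fun _ : Fin m => μ)
    (X := hits A) (t := 3) x (by norm_num)
    (integrable_exp_of_abs_le (measurable_hits hA) (abs_hits_le A) 3)
  refine h.trans ((mul_le_mul_of_nonneg_left hmgf (Real.exp_pos _).le).trans (le_of_eq ?_))
  rw [← Real.exp_add]
  congr 1
  ring

variable {n : ℕ}

lemma rInf_nonneg (D : Measure ((Fin n → ℝ) × ℝ)) (m : ℕ) : 0 ≤ rInf D m :=
  integral_nonneg fun _ => Real.iSup_nonneg fun _ => norm_nonneg _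

lemma norm_le_maxInputNorm (S : Fin m → (Fin n → ℝ) × ℝ) (k : Fin m) :
    ‖(S k).1‖ ≤ maxInputNorm S :=
  le_ciSup (f := fun k => ‖(S k).1‖) (Set.finite_range _).bddAbove k

lemma measure_lt_maxInputNorm_le (D : Measure ((Fin n → ℝ) × ℝ)) [IsProbabilityMeasure D]
    (hr : Integrable (fun S : Fin m → (Fin n → ℝ) × ℝ => maxInputNorm S) (sampleLaw D m)) :
    (sampleLaw D m).real {S | 22 * rInf D m < maxInputNorm S} ≤ 1 / 22 := by
  have hprob : IsProbabilityMeasure (sampleLaw D m) := by unfold sampleLaw; infer_instance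
  have hnn : ∀ S : Fin m → (Fin n → ℝ) × ℝ, 0 ≤ maxInputNorm S := fun S =>
    Real.iSup_nonneg fun _ => norm_nonneg _
  rcases (rInf_nonneg D m).eq_or_lt with h0 | hpos
  · have hz := (integral_eq_zero_iff_of_nonneg hnn hr).1 h0.symm
    have : (sampleLaw D m) {S | 22 * rInf D m < maxInputNorm S} = 0 := by
      rw [← h0]
      refine measure_mono_null (fun S hS => ?_) hz
      simp only [mul_zero, Set.mem_ofPred_eq] at hS
      exact hS.ne'
    rw [measureReal_def, this]
    norm_num
  · have h := mul_meas_ge_le_integral_of_nonneg (Filter.Eventually.of_forall hnn) hr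
      (22 * rInf D m)
    have h2 : (sampleLaw D m).real {S | 22 * rInf D m < maxInputNorm S} ≤
        (sampleLaw D m).real {S | 22 * rInf D m ≤ maxInputNorm S} :=
      measureReal_mono fun S hS => by
        simp only [Set.mem_ofPred_eq] at hS ⊢
        exact hS.le
    have h3 : 22 * rInf D m * (sampleLaw D m).real {S | 22 * rInf D m ≤ maxInputNorm S} ≤
        rInf D m := h
    have h4 : (sampleLaw D m).real {S | 22 * rInf D m ≤ maxInputNorm S} ≤ 1 / 22 := by
      rw [le_div_iff₀ (by norm_num)]
      refine le_of_mul_le_mul_left ?_ hpos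
      linarith
    exact h2.trans h4

/-- Every `weightProd` contains at least one factor 2 that the pointwise bound on the modules does
not need. It turns the norm threshold `22 * rInf` into the weight threshold `θ / 11`. -/
lemma sum_prod_le_half_sum_weightProd {lam : ℕ → ℝ} (hlam : ∀ t, 0 ≤ lam t) (T : ℕ) :
    ∑ t ∈ Finset.range (T + 1), ∏ s ∈ Finset.range (t + 1), lam s ≤
      (∑ t ∈ Finset.range (T + 1), weightProd lam t) / 2 := by
  rw [Finset.sum_div]
  refine Finset.sum_le_sum fun t _ => ?_
  rw [weightProd, Finset.prod_mul_distrib, Finset.prod_const, Finset.card_range, pow_succ]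
  have h1 : (1 : ℝ) ≤ 2 ^ t := one_le_pow₀ one_le_two
  have h2 : 0 ≤ ∏ s ∈ Finset.range (t + 1), lam s := Finset.prod_nonneg fun s _ => hlam s
  nlinarith

lemma trueError_le_one (D : Measure ((Fin n → ℝ) × ℝ)) [IsProbabilityMeasure D]
    (F : (Fin n → ℝ) → ℝ) : trueError D F ≤ 1 := measureReal_le_one

lemma marginError_nonneg (S : Fin m → (Fin n → ℝ) × ℝ) (θ : ℝ) (F : (Fin n → ℝ) → ℝ) :
    0 ≤ marginError S θ F := by unfold marginError; positivity

/-- The margin bound for networks whose output weights are so small that only inputs of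
exceptionally large norm can have a margin above `θ`. -/
theorem exists_measurableSet_small_weights_bound (hm : 0 < m) (T : ℕ)
    {σ : ℕ → ℝ → ℝ} (hσ : ∀ t, LipschitzWith 1 (σ t)) (hσ0 : ∀ t, σ t 0 = 0)
    {lam : ℕ → ℝ} (hlam : ∀ t, 0 ≤ lam t)
    (D : Measure ((Fin n → ℝ) × ℝ)) [IsProbabilityMeasure D]
    (hlabel : ∀ᵐ z ∂D, |z.2| ≤ 1)
    (hr : Integrable (fun S : Fin m → (Fin n → ℝ) × ℝ => maxInputNorm S) (sampleLaw D m))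
    {θ s : ℝ} (hs : s ≤ 1) (hsm : 1 ≤ s * m) :
    ∃ E : Set (Fin m → (Fin n → ℝ) × ℝ), MeasurableSet E ∧
      (sampleLaw D m).real Eᶜ ≤ Real.exp (-2 * m * s ^ 2) ∧
      ∀ S ∈ E, ∀ a : ℝ, 0 ≤ a →
        a * rInf D m * (∑ t ∈ Finset.range (T + 1), weightProd lam t) ≤ θ / 11 →
        ∀ f ∈ netFamily n T σ lam a, trueError D f ≤ marginError S θ f + s := by
  have hm' : (0 : ℝ) < m := by exact_mod_cast hm
  set r := rInf D m
  -- Labels outside `[-1, 1]` form a null set; including them in `A` makes the margin estimate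
  -- outside `A` valid at every point.
  set A : Set ((Fin n → ℝ) × ℝ) := {z | 22 * r < ‖z.1‖ ∨ 1 < |z.2|} with hAdef
  have hA : MeasurableSet A := by
    have e : A = {z | 22 * r < ‖z.1‖} ∪ {z | 1 < |z.2|} := by ext z; simp [hAdef]
    rw [e]
    refine (measurableSet_lt measurable_const ?_).union (measurableSet_lt measurable_const ?_)
    all_goals fun_prop
  have hsign : ∀ᵐ S ∂(sampleLaw D m), ∀ k, |(S k).2| ≤ 1 :=
    ae_all_iff.2 fun k =>
      (measurePreserving_eval (fun _ : Fin m => D) k).quasiMeasurePreserving.ae hlabel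
  have hprob : IsProbabilityMeasure (sampleLaw D m) := by unfold sampleLaw; infer_instance
  have hrare : (sampleLaw D m).real {S | ∃ k, S k ∈ A} ≤ 1 / 22 := by
    refine le_trans ?_ (measure_lt_maxInputNorm_le D hr)
    rw [measureReal_def, measureReal_def]
    refine ENNReal.toReal_mono (measure_ne_top _ _) (measure_mono_ae ?_)
    filter_upwards [hsign] with S hS
    rintro ⟨k, hk | hk⟩
    · exact hk.trans_le (norm_le_maxInputNorm S k)
    · exact absurd hk (not_lt.2 (hS k))
  refine ⟨{S | hits A S < s * m}, ?_, ?_, ?_⟩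
  · exact measurableSet_lt (measurable_hits hA) measurable_const
  · have e : {S : Fin m → (Fin n → ℝ) × ℝ | hits A S < s * m}ᶜ =
        {S | s * m ≤ hits A S} := by
      ext S; simp
    rw [e]
    -- The exponent satisfies `1 - 3 s m ≤ -2 s m ≤ -2 m s²`, by `1 ≤ s * m` and then `s ≤ 1`.
    refine (measure_count_ge_le D hA hrare (s * m)).trans (Real.exp_le_exp.2 ?_)
    have h0 : 0 < s := by
      by_contra h
      nlinarith
    have : m * s ^ 2 ≤ s * m := by nlinarith [mul_pos h0 hm']
    nlinarith
  · intro S hS a ha hsmall f hf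
    have hS' : hits A S < s * m := hS
    -- Every sample point lies in `A` or has margin at most `θ`. With fewer than `s * m` hits, the
    -- margin error exceeds `1 - s`, and the bound becomes trivial.
    have hcount : (m : ℝ) ≤ hits A S +
        ((Finset.univ.filter fun i => (S i).2 * f (S i).1 ≤ θ).card : ℝ) := by
      rw [Finset.card_filter, hits]
      push_cast
      rw [← Finset.sum_add_distrib]
      have : ∀ k ∈ Finset.univ, (1 : ℝ) ≤ A.indicator (1 : (Fin n → ℝ) × ℝ → ℝ) (S k) +
          if (S k).2 * f (S k).1 ≤ θ then 1 else 0 := by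
        intro k _
        by_cases hk : S k ∈ A
        · rw [Set.indicator_of_mem hk]
          split_ifs <;> simp
        · have hk' : ‖(S k).1‖ ≤ 22 * r ∧ |(S k).2| ≤ 1 := by
            simpa [hAdef, not_or] using hk
          have h1 : |f (S k).1| ≤ θ := by
            refine (abs_le_of_mem_netFamily hσ hσ0 hlam f hf _).trans ?_
            have h2 := sum_prod_le_half_sum_weightProd hlam T
            have h3 : 0 ≤ ∑ t ∈ Finset.range (T + 1), weightProd lam t :=
              Finset.sum_nonneg fun t _ => weightProd_nonneg hlam t
            have h4 := mul_le_mul_of_nonneg_left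
              (mul_le_mul h2 hk'.1 (norm_nonneg _) (by positivity)) ha
            linarith
          have h5 : (S k).2 * f (S k).1 ≤ θ := by
            refine (le_abs_self _).trans ?_
            rw [abs_mul]
            exact (mul_le_of_le_one_left (abs_nonneg _) hk'.2).trans h1
          rw [Set.indicator_of_notMem hk, if_pos h5, zero_add]
      simpa using Finset.sum_le_sum this
    have hmarg : 1 - s ≤ marginError S θ f := by
      rw [marginError, le_div_iff₀ hm']
      linarith
    linarith [trueError_le_one D f]

end RareEvent

/-! ### Peeling over the size of the output weights. -/

section Peeling

/-- Truncated subtraction makes the five terms with `k < 5` equal to 1; the remaining ones form a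
geometric series of sum 2. -/
lemma hasSum_half_pow_sub_five : HasSum (fun k : ℕ => (1 / 2 : ℝ) ^ (k - 5)) 7 := by
  have h : HasSum (fun k : ℕ => (1 / 2 : ℝ) ^ (k + 5 - 5)) 2 := by
    simpa using hasSum_geometric_two
  have h2 := (hasSum_nat_add_iff (f := fun k : ℕ => (1 / 2 : ℝ) ^ (k - 5)) 5).1 h
  have e : (7 : ℝ) = 2 + ∑ i ∈ Finset.range 5, (1 / 2 : ℝ) ^ (i - 5) := by
    norm_num [Finset.sum_range_succ]
  rw [e]
  exact h2

/-- Since `(3/2) ^ 6 > 11`, the square exceeds 1 at `k = 6`; from there it grows by a factor `9/4`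
per step, which Bernoulli's inequality compares with linear growth. -/
lemma sub_five_le_scale_sq (k : ℕ) : ((k - 5 : ℕ) : ℝ) ≤ ((3 / 2) ^ k / 11) ^ 2 := by
  rcases le_or_gt k 5 with h | h
  · rw [Nat.sub_eq_zero_of_le h]
    simpa using sq_nonneg _
  · obtain ⟨j, rfl⟩ := Nat.exists_eq_add_of_lt h
    have h1 := one_add_mul_le_pow (a := (5 / 4 : ℝ)) (by norm_num) j
    have e : ((3 / 2 : ℝ) ^ (5 + j + 1) / 11) ^ 2 = ((3 / 2) ^ 6 / 11) ^ 2 * (1 + 5 / 4) ^ j := by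
      have : (1 + 5 / 4 : ℝ) ^ j = ((3 / 2) ^ j) ^ 2 := by
        rw [← pow_mul, mul_comm, pow_mul]; norm_num
      rw [this]; ring
    have h2 : (1 : ℝ) ≤ ((3 / 2) ^ 6 / 11) ^ 2 := by norm_num
    have h3 : (0 : ℝ) ≤ (1 + 5 / 4) ^ j := by positivity
    rw [e, show 5 + j + 1 - 5 = j + 1 by omega]
    push_cast
    nlinarith [(Nat.cast_nonneg j : (0 : ℝ) ≤ j)]

lemma exp_neg_scale_le {L : ℝ} (hL : Real.log 2 ≤ L) (k : ℕ) :
    Real.exp (-(((3 / 2) ^ k / 11) ^ 2 * L)) ≤ (1 / 2 : ℝ) ^ (k - 5) := by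
  have h2 : 0 < Real.log 2 := Real.log_pos one_lt_two
  have e : (1 / 2 : ℝ) ^ (k - 5) = Real.exp (-(((k - 5 : ℕ) : ℝ) * Real.log 2)) := by
    rw [Real.exp_neg, Real.exp_nat_mul, Real.exp_log two_pos, one_div, inv_pow]
  rw [e]
  refine Real.exp_le_exp.2 (neg_le_neg ?_)
  exact mul_le_mul (sub_five_le_scale_sq k) hL h2.le (sq_nonneg _)

/-- A countable intersection of events whose failure probabilities are at most `ε * 2 ^ (5 - k)`,
with truncated exponents, together with one more event of failure probability at most `ε`. -/
lemma exists_measurableSet_subset_iInter {Ω : Type*} [MeasurableSpace Ω] (P : Measure Ω)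
    [IsProbabilityMeasure P] {ε : ℝ} (hε : 0 ≤ ε) {A : Set Ω} (hA : MeasurableSet A)
    (hAε : P.real Aᶜ ≤ ε) {E : ℕ → Set Ω} (hE : ∀ k, MeasurableSet (E k))
    (hEε : ∀ k, P.real (E k)ᶜ ≤ ε * (1 / 2 : ℝ) ^ (k - 5)) :
    MeasurableSet (A ∩ ⋂ k, E k) ∧ 1 - 8 * ε ≤ P.real (A ∩ ⋂ k, E k) := by
  have hmeas : MeasurableSet (A ∩ ⋂ k, E k) := hA.inter (MeasurableSet.iInter hE)
  refine ⟨hmeas, ?_⟩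
  have hsum := hasSum_half_pow_sub_five.mul_left ε
  have hU : P.real (⋃ k, (E k)ᶜ) ≤ ε * 7 := by
    refine ENNReal.toReal_le_of_le_ofReal (by positivity) ((measure_iUnion_le _).trans ?_)
    rw [← hsum.tsum_eq, ENNReal.ofReal_tsum_of_nonneg (fun k => by positivity) hsum.summable]
    refine ENNReal.tsum_le_tsum fun k => ?_
    rw [← ofReal_measureReal]
    exact ENNReal.ofReal_le_ofReal (hEε k)
  have hcompl : P.real (A ∩ ⋂ k, E k)ᶜ ≤ 8 * ε := by
    rw [Set.compl_inter, Set.compl_iInter]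
    refine (measureReal_union_le _ _).trans ?_
    linarith
  rw [probReal_compl_eq_one_sub hmeas] at hcompl
  linarith

variable {n m : ℕ}

/-- The margin bound uniformly over all output weights. -/
theorem exists_measurableSet_resNet_bound (hn : 0 < n) (hm : 0 < m) (T : ℕ)
    {σ : ℕ → ℝ → ℝ} (hσ : ∀ t, LipschitzWith 1 (σ t)) (hσ0 : ∀ t, σ t 0 = 0)
    {lam : ℕ → ℝ} (hlam : ∀ t, 0 ≤ lam t)
    (D : Measure ((Fin n → ℝ) × ℝ)) [IsProbabilityMeasure D]
    (hlabel : ∀ᵐ z ∂D, |z.2| ≤ 1)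
    (hr : Integrable (fun S : Fin m → (Fin n → ℝ) × ℝ => maxInputNorm S) (sampleLaw D m))
    {θ s : ℝ} (hθ : 0 < θ) (hs : s ≤ 1) (hsm : 1 ≤ s * m) :
    ∃ E : Set (Fin m → (Fin n → ℝ) × ℝ), MeasurableSet E ∧
      1 - 8 * Real.exp (-2 * m * s ^ 2) ≤ (sampleLaw D m).real E ∧
      ∀ S ∈ E, ∀ a : ℝ, 0 ≤ a → ∀ f ∈ netFamily n T σ lam a,
        trueError D f ≤ marginError S θ f +
          4 * (a * rInf D m * (∑ t ∈ Finset.range (T + 1), weightProd lam t) / θ) *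
            Real.sqrt (Real.log (2 * n) / (2 * m)) + s := by
  have hm' : (0 : ℝ) < m := by exact_mod_cast hm
  have hn' : (1 : ℝ) ≤ n := by exact_mod_cast hn
  have hs0 : 0 < s := by
    by_contra h
    nlinarith
  have hprob : IsProbabilityMeasure (sampleLaw D m) := by unfold sampleLaw; infer_instance
  set R := rInf D m * ∑ t ∈ Finset.range (T + 1), weightProd lam t with hR
  have hR0 : 0 ≤ R :=
    mul_nonneg (rInf_nonneg D m) (Finset.sum_nonneg fun t _ => weightProd_nonneg hlam t)
  set c := Real.sqrt (Real.log (2 * n) / (2 * m)) with hc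
  have hc0 : 0 ≤ c := Real.sqrt_nonneg _
  have hlog : Real.log 2 ≤ Real.log (2 * n) := Real.log_le_log two_pos (by linarith)
  have hlog0 : 0 < Real.log 2 := Real.log_pos one_lt_two
  have hc2 : 2 * m * c ^ 2 = Real.log (2 * n) := by
    rw [hc, Real.sq_sqrt (div_nonneg (by linarith) (by positivity))]
    field_simp
  obtain ⟨A, hA, hAε, hAb⟩ := exists_measurableSet_small_weights_bound hm T hσ hσ0 hlam D hlabel hr
    (θ := θ) hs hsm
  -- Thresholds for `a * R / θ`; the first, `1 / 11`, is where the small-weights bound stops.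
  set b : ℕ → ℝ := fun k => (3 / 2) ^ k / 11 with hb
  have hb0 : ∀ k, 0 ≤ b k := fun k => by positivity
  -- The cap is the upper end of the `k`-th range, and the extra deviation `b k * c` uses its lower
  -- end. If `R = 0` the cap is 0 by division by zero; this is harmless, since then all weights fall
  -- under the small-weights case.
  have hscale := fun k => exists_measurableSet_netFamily_bound hn hm T hσ hσ0 hlam D hlabel hr
    (a := b (k + 1) * θ / R) (s := s + b k * c) hθ
    (add_nonneg hs0.le (mul_nonneg (hb0 k) hc0))
    (div_nonneg (mul_nonneg (hb0 _) hθ.le) hR0)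
  choose E hE hEε hEb using hscale
  have hEε' : ∀ k, (sampleLaw D m).real (E k)ᶜ ≤
      Real.exp (-2 * m * s ^ 2) * (1 / 2 : ℝ) ^ (k - 5) := by
    intro k
    refine (hEε k).trans ?_
    refine le_trans ?_ (mul_le_mul_of_nonneg_left (exp_neg_scale_le hlog k) (Real.exp_pos _).le)
    rw [← Real.exp_add, ← hc2]
    refine Real.exp_le_exp.2 ?_
    -- Dropping the cross term of `(s + b k * c) ^ 2` leaves the factor `exp (-b k ^ 2 * log (2n))`,
    -- which is summable over `k`.
    have : 0 ≤ m * s * (b k * c) := by have := hb0 k; positivity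
    change _ ≤ -2 * m * s ^ 2 + -(b k ^ 2 * (2 * m * c ^ 2))
    nlinarith
  obtain ⟨hmeas, hP⟩ := exists_measurableSet_subset_iInter (sampleLaw D m)
    (Real.exp_pos (-2 * m * s ^ 2)).le hA hAε hE hEε'
  refine ⟨_, hmeas, hP, fun S hS a ha f hf => ?_⟩
  have e : a * rInf D m * (∑ t ∈ Finset.range (T + 1), weightProd lam t) = a * R := by
    rw [hR]; ring
  rcases le_or_gt (a * R) (θ / 11) with hsmall | hlarge
  · have h1 := hAb S hS.1 a ha (by rw [e]; exact hsmall) f hf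
    have h2 : 0 ≤ 4 * (a * rInf D m * (∑ t ∈ Finset.range (T + 1), weightProd lam t) / θ) * c := by
      rw [e]; positivity
    linarith
  · have hRpos : 0 < R := by
      rcases hR0.eq_or_lt with h | h
      · rw [← h, mul_zero] at hlarge
        linarith [div_pos hθ (by norm_num : (0 : ℝ) < 11)]
      · exact h
    have hx : 1 ≤ 11 * (a * R) / θ := by
      rw [one_le_div hθ]
      linarith
    obtain ⟨k, hk1, hk2⟩ := exists_nat_pow_near hx (by norm_num : (1 : ℝ) < 3 / 2)
    have hk1' : b k ≤ a * R / θ := by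
      rw [hb, div_le_iff₀ (by norm_num)]
      exact hk1.trans (le_of_eq (by ring))
    have hk2' : a ≤ b (k + 1) * θ / R := by
      rw [le_div_iff₀ hRpos, ← div_le_iff₀ hθ, hb, le_div_iff₀ (by norm_num)]
      exact le_trans (le_of_eq (by ring)) hk2.le
    have hf' : f ∈ netFamily n T σ lam (b (k + 1) * θ / R) := by
      obtain ⟨w, hw, hrest⟩ := hf
      exact ⟨w, hw.trans hk2', hrest⟩
    have h1 := hEb k S (Set.mem_iInter.1 hS.2 k) f hf'
    -- The complexity term is `2 * (3/2 * b k) * c`; adding the extra deviation `b k * c` gives `4 *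
    -- b k * c`, and `b k ≤ a * R / θ`.
    have e2 : b (k + 1) * θ / R * rInf D m * (∑ t ∈ Finset.range (T + 1), weightProd lam t) / θ =
        3 / 2 * b k := by
      rw [mul_assoc, ← hR, hb]
      simp only
      rw [pow_succ]
      field_simp
    rw [e2] at h1
    rw [e]
    have h3 := mul_le_mul_of_nonneg_right hk1' hc0
    linarith

end Peeling

end ResNetBound

/-! ### Choice of the deviation and conclusion. -/

open ResNetBound in
theorem mainTheorem4 (n m T : ℕ) (hn : 0 < n) (hm : 0 < m) (hT : 1 < T)
    (σ : ℕ → ℝ → ℝ) (hσ : ∀ t, LipschitzWith 1 (σ t)) (hσ0 : ∀ t, σ t 0 = 0)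
    (lam : ℕ → ℝ) (hlam : ∀ t, 0 ≤ lam t)
    (D : Measure ((Fin n → ℝ) × ℝ)) [IsProbabilityMeasure D]
    (hlabel : ∀ᵐ z ∂D, z.2 = 1 ∨ z.2 = -1)
    (hr : Integrable (fun S : Fin m → (Fin n → ℝ) × ℝ => maxInputNorm S) (sampleLaw D m))
    (θ δ : ℝ) (hθ : 0 < θ) (hδ0 : 0 < δ) (hδ1 : δ < 1) :
    ∃ E : Set (Fin m → (Fin n → ℝ) × ℝ), MeasurableSet E ∧
      1 - δ ≤ (sampleLaw D m).real E ∧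
      ∀ S ∈ E, ∀ w : Fin n → ℝ, ∀ f : ℕ → Fin n → (Fin n → ℝ) → ℝ,
        (∀ t ≤ T, ∀ j, f t j ∈ unitFamily n σ lam t) →
        trueError D (resNet T w f) ≤
          marginError S θ (resNet T w f)
          + 4 * (∑ j, |w j|) * rInf D m / θ * Real.sqrt (Real.log (2 * n) / (2 * m))
              * ∑ t ∈ Finset.range (T + 1), weightProd lam t
          + 2 / θ * Real.sqrt (Real.log T / m)
          + Real.sqrt
              ((⌈4 / θ ^ 2 * Real.log (θ ^ 2 * m / Real.log T)⌉ : ℝ) * (Real.log T / m)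
                + Real.log (2 / δ) / (2 * m)) := by
  have hm' : (0 : ℝ) < m := by exact_mod_cast hm
  have hT' : (2 : ℝ) ≤ T := by exact_mod_cast hT
  have hprob : IsProbabilityMeasure (sampleLaw D m) := by unfold sampleLaw; infer_instance
  have hlogT2 : Real.log 2 ≤ Real.log T := Real.log_le_log two_pos hT'
  have hlog2 : 0.69 < Real.log 2 := by linarith [Real.log_two_gt_d9]
  have hlogT : 0 < Real.log T := by linarith
  have hlogδ2 : Real.log 2 ≤ Real.log (2 / δ) :=
    Real.log_le_log two_pos ((le_div_iff₀ hδ0).2 (by linarith))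
  set B := ∑ t ∈ Finset.range (T + 1), weightProd lam t with hB
  have hB0 : 0 ≤ B := Finset.sum_nonneg fun t _ => weightProd_nonneg hlam t
  have hr0 := rInf_nonneg D m
  -- The last root of the bound with its ceiling replaced by 1.
  set s := Real.sqrt ((2 * Real.log T + Real.log (2 / δ)) / (2 * m)) with hs
  set q := Real.sqrt ((⌈4 / θ ^ 2 * Real.log (θ ^ 2 * m / Real.log T)⌉ : ℝ) * (Real.log T / m)
    + Real.log (2 / δ) / (2 * m)) with hq
  set p := 2 / θ * Real.sqrt (Real.log T / m) with hp
  have hp0 : 0 ≤ p := by positivity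
  have hq0 : 0 ≤ q := Real.sqrt_nonneg _
  have hmain0 : ∀ w : Fin n → ℝ, 0 ≤ 4 * (∑ j, |w j|) * rInf D m / θ *
      Real.sqrt (Real.log (2 * n) / (2 * m)) * B := fun w => by positivity
  by_cases htriv : 1 ≤ p + q
  · refine ⟨Set.univ, MeasurableSet.univ, by rw [probReal_univ]; linarith,
      fun S _ w f hf => ?_⟩
    have h1 := trueError_le_one D (resNet T w f)
    have h2 := marginError_nonneg S θ (resNet T w f)
    linarith [hmain0 w]
  have hpq : p + q < 1 := not_le.1 htriv
  -- Otherwise `p ≥ 2` and the bound is trivial. Hence the logarithm is positive, the ceiling is at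
  -- least 1, and the argument of the root is not negative.
  have hratio : 1 < θ ^ 2 * m / Real.log T := by
    by_contra h
    have h1 : θ ^ 2 ≤ Real.log T / m := by
      rw [not_lt, div_le_one hlogT] at h
      rwa [le_div_iff₀ hm']
    have h2 : θ ≤ Real.sqrt (Real.log T / m) := Real.le_sqrt_of_sq_le h1
    have h3 : 2 / θ * θ ≤ p := mul_le_mul_of_nonneg_left h2 (by positivity)
    rw [div_mul_cancel₀ _ hθ.ne'] at h3
    linarith
  have hceil : (1 : ℝ) ≤ (⌈4 / θ ^ 2 * Real.log (θ ^ 2 * m / Real.log T)⌉ : ℝ) := by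
    have : 0 < 4 / θ ^ 2 * Real.log (θ ^ 2 * m / Real.log T) :=
      mul_pos (by positivity) (Real.log_pos hratio)
    exact_mod_cast Int.one_le_ceil_iff.2 this
  have hsq : s ≤ q := by
    refine Real.sqrt_le_sqrt ?_
    have h1 : 1 * (Real.log T / m) ≤ _ :=
      mul_le_mul_of_nonneg_right hceil (div_nonneg hlogT.le hm'.le)
    have e : (2 * Real.log T + Real.log (2 / δ)) / (2 * m) =
        1 * (Real.log T / m) + Real.log (2 / δ) / (2 * m) := by field_simp
    rw [e]
    linarith
  have hs2 : s ^ 2 * (2 * m) = 2 * Real.log T + Real.log (2 / δ) := by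
    rw [hs, Real.sq_sqrt (div_nonneg (by linarith) (by positivity))]
    field_simp
  have hs0 : 0 ≤ s := Real.sqrt_nonneg _
  have hs1 : s ≤ 1 := by linarith
  -- From `T ≥ 2` and `2 / δ ≥ 2` one has `s² m ≥ (3/2) log 2 > 1`, and `s² ≤ s`.
  have hsm : 1 ≤ s * m := by
    have h1 : s ^ 2 * m ≤ s * m := by
      refine mul_le_mul_of_nonneg_right ?_ hm'.le
      nlinarith
    linarith
  have hlabel' : ∀ᵐ z ∂D, |z.2| ≤ 1 := by
    filter_upwards [hlabel] with z hz
    rcases hz with h | h <;> simp [h]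
  obtain ⟨E, hE, hEp, hEb⟩ := exists_measurableSet_resNet_bound hn hm T hσ hσ0 hlam D hlabel' hr
    hθ hs1 hsm
  refine ⟨E, hE, le_trans ?_ hEp, fun S hS w f hf => ?_⟩
  -- The term `2 log T` in `s` yields `T⁻² ≤ 1/4`, so eight failure terms cost at most `8 * (1/4) *
  -- (δ/2) = δ`.
  · have e : Real.exp (-2 * m * s ^ 2) = ((T : ℝ) ^ 2)⁻¹ * (δ / 2) := by
      have : -2 * m * s ^ 2 = -(2 * Real.log T) + -Real.log (2 / δ) := by linarith
      rw [this, Real.exp_add, Real.exp_neg, Real.exp_neg, Real.exp_log (by positivity), inv_div,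
        show (2 : ℝ) * Real.log T = (2 : ℕ) * Real.log T by norm_num, Real.exp_nat_mul,
        Real.exp_log (by linarith)]
    have h4 : ((T : ℝ) ^ 2)⁻¹ ≤ 4⁻¹ := inv_anti₀ (by norm_num) (by nlinarith)
    rw [e]
    nlinarith
  · have h := hEb S hS (∑ j, |w j|) (Finset.sum_nonneg fun j _ => abs_nonneg _) (resNet T w f)
      ⟨w, le_rfl, f, hf, rfl⟩
    have e : 4 * ((∑ j, |w j|) * rInf D m * B / θ) * Real.sqrt (Real.log (2 * n) / (2 * m)) =
        4 * (∑ j, |w j|) * rInf D m / θ * Real.sqrt (Real.log (2 * n) / (2 * m)) * B := by ring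
    rw [e] at h
    linarith
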